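/- For a pointed simplicial set $S$ let $F(S)$ be Milnor's construction, i.e. the simplicial group whose group $F(S)_m$ of $m$-simplices is the free group on the set $S_m$ modulo the single relation that the base point of $S_m$ equals $1$, with simplicial structure induced from $S$. Let $K(S)$ (Cohen's construction) be the quotient of the simplicial group $F(S)$ by the normal simplicial subgroup generated by all left-normed commutators $[[\cdots[x_1,x_2],\cdots],x_t]$ with $x_1,\dots,x_t\in S_m$ (for all $m$) and $x_i=x_j$ for some $1\le i<j\le t$. For $n\ge 0$ let $L(x_1,\dots,x_n)$ be the free Lie algebra over $\mathbb Z$ on $x_1,\dots,x_n$, let $I$ be the Lie ideal generated by all left-normed brackets $[[\cdots[x_{i_1},x_{i_2}],\cdots],x_{i_t}]$ with $i_l=i_k$ for some $1\le l<k\le t$, and let $\mathrm{Lie}(n)$ be the additive group of elements of weight $n$ of $L(x_1,\dots,x_n)/I$, i.e. the subgroup spanned by the iterated brackets of $n$ generators (so $\mathrm{Lie}(0)=0$). Let $S^1=\Delta[1]/\partial\Delta[1]$ be the simplicial circle. **Theorem.** For every $n\ge 0$ there is an isomorphism of groups $$\pi_n(K(S^1))\cong \mathrm{Lie}(n).$$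 Moreover, the homomorphism $\pi_n(F(S^1))\to\pi_n(K(S^1))$ induced by the quotient map $F(S^1)\to K(S^1)$ is an isomorphism for $n=1$ and $n=2$, and is zero for every $n>2$. -/

import Mathlib

universe u

namespace CohenK

/-! ### The group `Lie(n)` -/

/-- The Lie ideal of the free Lie ring on `x₁, …, xₙ` generated by the left-normed brackets in which
some generator occurs at least twice. -/
noncomputable def repeatedIdeal (n : ℕ) : LieIdeal ℤ (FreeLieAlgebra ℤ (Fin n)) :=
  LieSubmodule.lieSpan ℤ (FreeLieAlgebra ℤ (Fin n))
    {a | ∃ (i : Fin n) (l : List (Fin n)), ¬ (i :: l).Nodup ∧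
      a = l.foldl (fun b j => ⁅b, FreeLieAlgebra.of ℤ j⁆) (FreeLieAlgebra.of ℤ i)}

/-- `IsBracket x w a`: the element `a` is an iterated bracket (with any arrangement of brackets) of
`w` of the elements `x i`, counted with multiplicity. -/
inductive IsBracket {ι L : Type} [LieRing L] (x : ι → L) : ℕ → L → Prop
  | gen (i : ι) : IsBracket x 1 (x i)
  | lie {p q : ℕ} {a b : L} : IsBracket x p a → IsBracket x q b → IsBracket x (p + q) ⁅a, b⁆

/-- The group `Lie(n)`: the elements of weight `n` of the quotient Lie ring, i.e. the additive
subgroup spanned by the iterated brackets of `n` generators. -/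
noncomputable abbrev LieN (n : ℕ) :
    Submodule ℤ (FreeLieAlgebra ℤ (Fin n) ⧸ repeatedIdeal n) :=
  Submodule.span ℤ {a | IsBracket
    (fun i : Fin n => LieSubmodule.Quotient.mk (N := repeatedIdeal n) (FreeLieAlgebra.of ℤ i)) n a}

open CategoryTheory Simplicial Opposite
open scoped commutatorElement

/-! ### Homotopy groups of simplicial groups -/

/-- The `n`-simplices of the simplicial group `G` all of whose faces are trivial, i.e. the
`n`-simplices `Δ[n] ⟶ G` sending the boundary of `Δ[n]` to `1` (for `n = 0`: all vertices). -/
def cycles (G : SimplicialObject GrpCat.{u}) (n : ℕ) : Subgroup (G _⦋n⦌) :=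
  match n with
  | 0 => ⊤
  | _ + 1 => ⨅ i, (G.δ i).hom.ker

/-- Homotopy relative to the boundary: `x` and `y` are consecutive faces of an `(n + 1)`-simplex
all of whose other faces are trivial. -/
def Homotopic (G : SimplicialObject GrpCat.{u}) (n : ℕ) (x y : cycles G n) : Prop :=
  ∃ w : G _⦋n + 1⦌, (G.δ 0).hom w = (x : G _⦋n⦌) ∧ (G.δ 1).hom w = (y : G _⦋n⦌) ∧
    ∀ i : Fin (n + 2), 2 ≤ (i : ℕ) → (G.δ i).hom w = 1

lemma homotopic_refl (G : SimplicialObject GrpCat.{u}) (n : ℕ) (x : cycles G n) :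
    Homotopic G n x x := by
  refine ⟨(G.σ 0).hom (x : G _⦋n⦌), ?_, ?_, ?_⟩
  · exact ConcreteCategory.congr_hom (G.δ_comp_σ_self (i := (0 : Fin (n + 1)))) (x : G _⦋n⦌)
  · exact ConcreteCategory.congr_hom (G.δ_comp_σ_succ (i := (0 : Fin (n + 1)))) (x : G _⦋n⦌)
  · intro i hi
    cases n with
    | zero => omega
    | succ m =>
      obtain ⟨x, hx⟩ := x
      have h := ConcreteCategory.congr_hom
        (G.δ_comp_σ_of_gt' (i := i) (j := (0 : Fin (m + 2))) (by
          rw [Fin.lt_def]; simp; omega)) x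
      refine h.trans ?_
      have hk : (G.δ (i.pred (by rintro rfl; simp at hi))).hom x = 1 :=
        (Subgroup.mem_iInf.1 hx) _
      refine (congrArg (G.σ _).hom hk).trans (map_one _)

/-- Homotopy is a congruence for the multiplication of simplices. -/
def homotopyCon (G : SimplicialObject GrpCat.{u}) (n : ℕ) : Con (cycles G n) where
  r := Homotopic G n
  iseqv :=
    { refl := homotopic_refl G n
      symm := by
        rintro x y ⟨w, h0, h1, h2⟩
        obtain ⟨a, a0, a1, a2⟩ := homotopic_refl G n x
        obtain ⟨b, b0, b1, b2⟩ := homotopic_refl G n y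
        refine ⟨a * w⁻¹ * b, ?_, ?_, fun i hi => ?_⟩
        · rw [map_mul, map_mul, map_inv, h0, a0, b0]; group
        · rw [map_mul, map_mul, map_inv, h1, a1, b1]; group
        · rw [map_mul, map_mul, map_inv, h2 i hi, a2 i hi, b2 i hi]; group
      trans := by
        rintro x y z ⟨w, h0, h1, h2⟩ ⟨v, k0, k1, k2⟩
        obtain ⟨b, b0, b1, b2⟩ := homotopic_refl G n y
        refine ⟨w * b⁻¹ * v, ?_, ?_, fun i hi => ?_⟩
        · rw [map_mul, map_mul, map_inv, h0, b0, k0]; group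
        · rw [map_mul, map_mul, map_inv, h1, b1, k1]; group
        · rw [map_mul, map_mul, map_inv, h2 i hi, b2 i hi, k2 i hi]; group }
  mul' := by
    rintro x y z t ⟨w, h0, h1, h2⟩ ⟨v, k0, k1, k2⟩
    refine ⟨w * v, ?_, ?_, fun i hi => ?_⟩
    · rw [map_mul, h0, k0]; rfl
    · rw [map_mul, h1, k1]; rfl
    · rw [map_mul, h2 i hi, k2 i hi, one_mul]

/-- The `n`-th homotopy group of the simplicial group `G` (based at the identity): homotopy classes
of `n`-simplices with trivial boundary, with the multiplication induced by that of `G` (which for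
`n ≥ 1` coincides with the multiplication of the homotopy groups of the Kan complex underlying
`G`). -/
abbrev HomotopyGrp (n : ℕ) (G : SimplicialObject GrpCat.{u}) : Type u :=
  (homotopyCon G n).Quotient

lemma map_mem_cycles {G H : SimplicialObject GrpCat.{u}} (f : G ⟶ H) (n : ℕ) {x : G _⦋n⦌}
    (hx : x ∈ cycles G n) : (f.app (op ⦋n⦌)).hom x ∈ cycles H n := by
  cases n with
  | zero => exact Subgroup.mem_top _
  | succ m =>
    refine Subgroup.mem_iInf.2 fun i => ?_
    have h := ConcreteCategory.congr_hom (f.naturality (SimplexCategory.δ i).op) x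
    have hk : (G.δ i).hom x = 1 := (Subgroup.mem_iInf.1 hx) i
    exact (h.symm.trans (congrArg (f.app _).hom hk)).trans (map_one _)

/-- The homomorphism induced on simplices with trivial boundary. -/
def cyclesMap {G H : SimplicialObject GrpCat.{u}} (f : G ⟶ H) (n : ℕ) :
    cycles G n →* cycles H n :=
  ((f.app (op ⦋n⦌)).hom.comp (cycles G n).subtype).codRestrict _
    fun x => map_mem_cycles f n x.2

/-- The homomorphism induced on homotopy groups by a morphism of simplicial groups. -/
def homotopyMap (n : ℕ) {G H : SimplicialObject GrpCat.{u}} (f : G ⟶ H) :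
    HomotopyGrp n G →* HomotopyGrp n H :=
  (homotopyCon G n).lift ((homotopyCon H n).mk'.comp (cyclesMap f n)) (by
    rintro x y ⟨w, h0, h1, h2⟩
    refine (Con.eq _).2 ⟨(f.app _).hom w, ?_, ?_, fun i hi => ?_⟩
    · exact (ConcreteCategory.congr_hom (f.naturality (SimplexCategory.δ 0).op) w).symm.trans
        (congrArg (f.app _).hom h0)
    · exact (ConcreteCategory.congr_hom (f.naturality (SimplexCategory.δ 1).op) w).symm.trans
        (congrArg (f.app _).hom h1)
    · exact ((ConcreteCategory.congr_hom (f.naturality (SimplexCategory.δ i).op) w).symm.trans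
        (congrArg (f.app _).hom (h2 i hi))).trans (map_one _))

/-! ### Milnor's construction and Cohen's construction -/

section Constructions

variable (S : SSet.{u}) (pt : S _⦋0⦌)

/-- The base point in each degree: the degenerate simplices of the vertex `pt`. -/
def basePt (m : SimplexCategoryᵒᵖ) : S.obj m :=
  S.map (SimplexCategory.const m.unop ⦋0⦌ 0).op pt

lemma map_basePt {m k : SimplexCategoryᵒᵖ} (f : m ⟶ k) :
    S.map f (basePt S pt m) = basePt S pt k := by
  have h : (SimplexCategory.const m.unop ⦋0⦌ 0).op ≫ f =
      (SimplexCategory.const k.unop ⦋0⦌ 0).op := rfl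
  rw [basePt, basePt, ← h, S.map_comp]
  rfl

/-- The free group on a set of simplices, with the base point identified with `1`. -/
abbrev MilnorGrp (m : SimplexCategoryᵒᵖ) : Type u :=
  FreeGroup (S.obj m) ⧸ Subgroup.normalClosure {FreeGroup.of (basePt S pt m)}

/-- The generator of Milnor's construction given by a simplex. -/
def milnorOf (m : SimplexCategoryᵒᵖ) (x : S.obj m) : MilnorGrp S pt m :=
  QuotientGroup.mk (FreeGroup.of x)

/-- The structure maps of Milnor's construction, induced by those of `S` on generators. -/
def milnorMap {m k : SimplexCategoryᵒᵖ} (f : m ⟶ k) :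
    MilnorGrp S pt m →* MilnorGrp S pt k :=
  QuotientGroup.map _ _ (FreeGroup.map (S.map f)) (by
    refine Subgroup.normalClosure_le_normal ?_
    rintro _ rfl
    refine Subgroup.subset_normalClosure ?_
    simp [map_basePt])

@[simp] lemma milnorMap_of {m k : SimplexCategoryᵒᵖ} (f : m ⟶ k) (x : S.obj m) :
    milnorMap S pt f (milnorOf S pt m x) = milnorOf S pt k (S.map f x) := by
  simp [milnorMap, milnorOf]

lemma milnor_hom_ext {m : SimplexCategoryᵒᵖ} {A : Type u} [Group A] {f g : MilnorGrp S pt m →* A}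
    (h : ∀ x, f (milnorOf S pt m x) = g (milnorOf S pt m x)) : f = g := by
  refine QuotientGroup.monoidHom_ext _ (FreeGroup.ext_hom _ _ fun x => h x)

/-- Milnor's construction `F(S)` on the pointed simplicial set `(S, pt)`. -/
def milnorF : SimplicialObject GrpCat.{u} where
  obj m := GrpCat.of (MilnorGrp S pt m)
  map f := GrpCat.ofHom (milnorMap S pt f)
  map_id m := by
    refine GrpCat.hom_ext (milnor_hom_ext S pt fun x => ?_)
    simp
  map_comp f g := by
    refine GrpCat.hom_ext (milnor_hom_ext S pt fun x => ?_)
    simp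

/-- The left-normed commutator `[[…[[g, g₁], g₂], …], gₜ]`, for `l = [g₁, …, gₜ]`. -/
def leftCommutator {A : Type u} [Group A] (g : A) (l : List A) : A :=
  l.foldl (fun a b => ⁅a, b⁆) g

lemma map_leftCommutator {A B : Type u} [Group A] [Group B] (f : A →* B) (g : A) (l : List A) :
    f (leftCommutator g l) = leftCommutator (f g) (l.map f) := by
  induction l generalizing g with
  | nil => rfl
  | cons a l ih =>
    have := ih ⁅g, a⁆
    rw [map_commutatorElement] at this
    exact this

/-- The left-normed commutators in the simplices of a fixed degree in which some simplex occurs at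
least twice. -/
def repeatedCommutators (m : SimplexCategoryᵒᵖ) : Set (MilnorGrp S pt m) :=
  {g | ∃ (x : S.obj m) (l : List (S.obj m)), ¬ (x :: l).Nodup ∧
    g = leftCommutator (milnorOf S pt m x) (l.map (milnorOf S pt m))}

/-- The simplices of Cohen's construction. -/
abbrev CohenGrp (m : SimplexCategoryᵒᵖ) : Type u :=
  MilnorGrp S pt m ⧸ Subgroup.normalClosure (repeatedCommutators S pt m)

/-- The structure maps of Cohen's construction, induced by those of Milnor's construction. -/
def cohenMap {m k : SimplexCategoryᵒᵖ} (f : m ⟶ k) : CohenGrp S pt m →* CohenGrp S pt k :=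
  QuotientGroup.map _ _ (milnorMap S pt f) (by
    refine Subgroup.normalClosure_le_normal ?_
    rintro _ ⟨x, l, hl, rfl⟩
    refine Subgroup.subset_normalClosure ⟨S.map f x, l.map (S.map f), ?_, ?_⟩
    · exact fun h => hl (List.Nodup.of_map (S.map f) (by simpa using h))
    · rw [map_leftCommutator]
      simp [Function.comp_def])

/-- Cohen's construction `K(S)` on the pointed simplicial set `(S, pt)`. -/
def cohenK : SimplicialObject GrpCat.{u} where
  obj m := GrpCat.of (CohenGrp S pt m)
  map f := GrpCat.ofHom (cohenMap S pt f)
  map_id m := by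
    refine GrpCat.hom_ext (QuotientGroup.monoidHom_ext _ ?_)
    refine congrArg (fun h : MilnorGrp S pt m →* MilnorGrp S pt m =>
      (QuotientGroup.mk' (Subgroup.normalClosure (repeatedCommutators S pt m))).comp h)
      (milnor_hom_ext S pt (f := milnorMap S pt (𝟙 m)) (g := MonoidHom.id _) fun x => ?_)
    simp
  map_comp {m k r} f g := by
    refine GrpCat.hom_ext (QuotientGroup.monoidHom_ext _ ?_)
    refine congrArg (fun h : MilnorGrp S pt m →* MilnorGrp S pt r =>
      (QuotientGroup.mk' (Subgroup.normalClosure (repeatedCommutators S pt r))).comp h)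
      (milnor_hom_ext S pt (f := milnorMap S pt (f ≫ g))
        (g := (milnorMap S pt g).comp (milnorMap S pt f)) fun x => ?_)
    simp

/-- The quotient morphism `F(S) ⟶ K(S)` of simplicial groups. -/
def quotientMap : milnorF S pt ⟶ cohenK S pt where
  app m := GrpCat.ofHom (QuotientGroup.mk' (Subgroup.normalClosure (repeatedCommutators S pt m)))
  naturality _ _ _ := rfl

end Constructions

/-- The base point of the simplicial circle `Δ[1] / ∂Δ[1]`: the image of a vertex of `Δ[1]`. -/
noncomputable def circlePt : SSet.S1 _⦋0⦌ :=
  (Limits.colimit.ι (Limits.parallelPair (SSet.stdSimplex.δ 0 : Δ[0] ⟶ Δ[1])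
    (SSet.stdSimplex.δ 1)) Limits.WalkingParallelPair.one).app (op ⦋0⦌)
    (SSet.stdSimplex.obj₀Equiv.symm 0)

/-- The simplicial group `F(S¹)`. -/
noncomputable abbrev FS1 : SimplicialObject GrpCat.{0} := milnorF SSet.S1 circlePt

/-- The simplicial group `K(S¹)`. -/
noncomputable abbrev KS1 : SimplicialObject GrpCat.{0} := cohenK SSet.S1 circlePt

end CohenK

namespace CohenK

open CategoryTheory Simplicial Opposite
open scoped commutatorElement

/-! ### The simplices of the simplicial circle -/

/-! Besides the base point, the circle has the `n`-simplices `x_1, …, x_n`. The face `d_i` merges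
`x_i` and `x_{i+1}` and lowers the later indices, where in every degree `m` the symbols `x_0` and
`x_{m+1}` mean `1`. Elements of `F(S¹)_n` are studied through the Magnus expansion `x_k ↦ 1 + y_k`.
When words with a repeated letter are discarded, it factors through `K(S¹)_n` (`multilinear`),
because a bracket with a repeated letter vanishes there.

Homotopy of `K(S¹)`. The kernel of the last face of `K(S¹)_{n+1}` is generated by the left-normed
commutators that start with `x_{n+1}`, and it is abelian. Such a commutator expands to `1 +` the
corresponding bracket of letters. The only term of this bracket that starts with `n+1` is the word
of the commutator itself, so the coefficients at words starting with `n+1` are coordinates on this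
kernel (`mem_closure_of_coeffK`). If all faces except `d_0` are trivial, the coefficients at words
missing a letter vanish (`coeffK_eq_zero`), so only commutators containing every generator once
survive. For these `d_0` is trivial as well (`faceK_eq_one`). Hence there are no nontrivial
boundaries, and the homotopy group is the group of cycles. The same duality makes the brackets
`[[x_{n+1}, x_{l_1}], …]`, with `l` a permutation of `1, …, n`, a basis of `Lie(n+1)`.

The map from `F(S¹)`. For a cycle of `F(S¹)`, trivial faces force the coefficients at permutation
words to be alternating. The expansion of a group element also satisfies shuffle relations.
Shuffling two letters with the `m` remaining ones counts, with signs, `⌊m/2⌋ + 1 ≠ 0` times the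
coefficient of the full word. The corresponding product of coefficients is `0`, since a two-letter
word misses a letter when there are at least three. So the image in `K(S¹)` is trivial in degrees
above `2` (`coeff_fullWords_eq_zero`). In degrees `1` and `2` the cycles `x_1` and `[x_2, x_1]`
lift, and the kernel of the projection consists of boundaries because explicit 3-simplices bound the
triple commutators (`ker_toK_le_boundaries`). -/

/-- The quotient morphism `Δ[1] ⟶ S¹`. -/
noncomputable def circleProj : (Δ[1] : SSet.{0}) ⟶ SSet.S1 :=
  Limits.colimit.ι (Limits.parallelPair (SSet.stdSimplex.δ 0 : Δ[0] ⟶ Δ[1])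
    (SSet.stdSimplex.δ 1)) Limits.WalkingParallelPair.one

/-- The monotone map `[n] → [1]` sending exactly the elements smaller than `k` to `0`. -/
def cut (n k : ℕ) : Fin (n + 1) →o Fin 2 where
  toFun j := if (j : ℕ) < k then 0 else 1
  monotone' a b h := by
    have h' : (a : ℕ) ≤ b := h
    dsimp only
    split_ifs
    · exact le_rfl
    · exact Fin.zero_le _
    · omega
    · exact le_rfl

/-- The `n`-simplex of the circle given by the monotone map `cut n k`. -/
noncomputable def circleSimplex (n k : ℕ) : SSet.S1 _⦋n⦌ :=
  circleProj.app (op ⦋n⦌) (SSet.stdSimplex.objEquiv.symm (SimplexCategory.Hom.mk (cut n k)))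

lemma circleProj_condition :
    (SSet.stdSimplex.δ 0 : (Δ[0] : SSet.{0}) ⟶ Δ[1]) ≫ circleProj =
      SSet.stdSimplex.δ 1 ≫ circleProj :=
  (Limits.colimit.w (Limits.parallelPair (SSet.stdSimplex.δ 0 : (Δ[0] : SSet.{0}) ⟶ Δ[1])
    (SSet.stdSimplex.δ 1)) Limits.WalkingParallelPairHom.left).trans
  (Limits.colimit.w (Limits.parallelPair (SSet.stdSimplex.δ 0 : (Δ[0] : SSet.{0}) ⟶ Δ[1])
    (SSet.stdSimplex.δ 1)) Limits.WalkingParallelPairHom.right).symm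

lemma circleSimplex_map {m n : ℕ} (f : ⦋m⦌ ⟶ ⦋n⦌) {k k' : ℕ}
    (h : ∀ j : Fin (m + 1), ((f.toOrderHom j : ℕ) < k ↔ (j : ℕ) < k')) :
    SSet.S1.map f.op (circleSimplex n k) = circleSimplex m k' := by
  have h1 := ConcreteCategory.congr_hom (circleProj.naturality f.op)
    (SSet.stdSimplex.objEquiv.symm (SimplexCategory.Hom.mk (cut n k)))
  refine h1.symm.trans (congrArg (circleProj.app (op ⦋m⦌)) ?_)
  refine SSet.stdSimplex.ext _ _ fun j => ?_
  change (if ((f.toOrderHom j : ℕ) < k) then (0 : Fin 2) else 1) = if (j : ℕ) < k' then 0 else 1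
  simp only [h]

lemma circlePt_eq : circlePt = circleSimplex 0 1 := by
  refine congrArg (circleProj.app (op ⦋0⦌)) ?_
  refine SSet.stdSimplex.ext _ _ fun j => ?_
  fin_cases j
  rfl

lemma circleSimplex_zero_eq : circleSimplex 0 0 = circleSimplex 0 1 := by
  have h := ConcreteCategory.congr_hom (NatTrans.congr_app circleProj_condition (op ⦋0⦌))
    (SSet.stdSimplex.objEquiv.symm (𝟙 ⦋0⦌))
  refine Eq.trans (congrArg (circleProj.app (op ⦋0⦌)) ?_)
    (h.trans (congrArg (circleProj.app (op ⦋0⦌)) ?_))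
  · refine SSet.stdSimplex.ext _ _ fun j => ?_
    fin_cases j
    rfl
  · refine SSet.stdSimplex.ext _ _ fun j => ?_
    fin_cases j
    rfl

lemma circleSimplex_eq_basePt {n k : ℕ} (h : k = 0 ∨ n < k) :
    circleSimplex n k = basePt SSet.S1 circlePt (op ⦋n⦌) := by
  rw [basePt, circlePt_eq]
  rcases h with rfl | h
  · rw [← circleSimplex_zero_eq]
    exact (circleSimplex_map _ fun j => by simp).symm
  · refine (circleSimplex_map _ fun j => ?_).symm
    have := j.2
    simp
    omega

lemma fin_two_eq_zero_or_one (a : Fin 2) : a = 0 ∨ a = 1 := by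
  fin_cases a <;> simp

lemma exists_circleSimplex_eq (n : ℕ) (x : SSet.S1 _⦋n⦌) :
    ∃ k ≤ n, x = circleSimplex n k := by
  have key : ∃ k, x = circleSimplex n k := by
    obtain ⟨j, y, hy⟩ := Limits.Types.jointly_surjective _
      (Limits.isColimitOfPreserves ((evaluation _ _).obj (op ⦋n⦌))
        (Limits.colimit.isColimit (Limits.parallelPair
          (SSet.stdSimplex.δ 0 : (Δ[0] : SSet.{0}) ⟶ Δ[1]) (SSet.stdSimplex.δ 1)))) x
    have key2 : ∃ y : Δ[1] _⦋n⦌, circleProj.app (op ⦋n⦌) y = x := by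
      cases j with
      | one => exact ⟨y, hy⟩
      | zero =>
        refine ⟨(SSet.stdSimplex.δ 0 : (Δ[0] : SSet.{0}) ⟶ Δ[1]).app (op ⦋n⦌) y, ?_⟩
        refine Eq.trans ?_ hy
        exact ConcreteCategory.congr_hom (NatTrans.congr_app (Limits.colimit.w
          (Limits.parallelPair (SSet.stdSimplex.δ 0 : (Δ[0] : SSet.{0}) ⟶ Δ[1])
            (SSet.stdSimplex.δ 1)) Limits.WalkingParallelPairHom.left) (op ⦋n⦌)) y
    obtain ⟨y, rfl⟩ := key2
    by_cases h : ∃ j : Fin (n + 1), y j = 1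
    · classical
      obtain ⟨j0, hj0⟩ := h
      have hex : ∃ k : ℕ, ∃ h : k < n + 1, y ⟨k, h⟩ = 1 := ⟨j0, j0.2, hj0⟩
      -- A monotone map to `{0, 1}` is determined by the first place where it takes the value `1`.
      refine ⟨Nat.find hex, congrArg (circleProj.app (op ⦋n⦌)) ?_⟩
      refine SSet.stdSimplex.ext _ _ fun j => ?_
      change y j = if (j : ℕ) < Nat.find hex then (0 : Fin 2) else 1
      split_ifs with hj
      · have := Nat.find_min hex hj
        push Not at this
        have := this j.2
        exact (fin_two_eq_zero_or_one (y j)).resolve_right this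
      · obtain ⟨h1, h2⟩ := Nat.find_spec hex
        have hm := SSet.stdSimplex.monotone_apply y
          (show (⟨Nat.find hex, h1⟩ : Fin (n + 1)) ≤ j from Fin.mk_le_of_le_val (by omega))
        dsimp only at hm
        rw [h2] at hm
        exact le_antisymm (Fin.le_last _) hm
    · push Not at h
      -- The constant map `0` has all its `n + 1` values below the cut; it gives the base point, so
      -- the index is replaced by `0` at the end.
      refine ⟨n + 1, congrArg (circleProj.app (op ⦋n⦌)) ?_⟩
      refine SSet.stdSimplex.ext _ _ fun j => ?_
      change y j = if (j : ℕ) < n + 1 then (0 : Fin 2) else 1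
      rw [if_pos j.2]
      exact (fin_two_eq_zero_or_one (y j)).resolve_right (h j)
  obtain ⟨k, hk⟩ := key
  by_cases h : k ≤ n
  · exact ⟨k, h, hk⟩
  · refine ⟨0, Nat.zero_le _, hk.trans ?_⟩
    rw [circleSimplex_eq_basePt (Or.inr (by omega)), circleSimplex_eq_basePt (Or.inl rfl)]

/-- The number of zeros of a nonconstant map `[n] → [1]`, and `0` for constant maps. -/
def rawIndex (n : ℕ) (y : (Δ[1] : SSet.{0}) _⦋n⦌) : ℕ :=
  if Finset.card (Finset.univ.filter fun j : Fin (n + 1) => y j = 0) = n + 1 then 0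
  else Finset.card (Finset.univ.filter fun j : Fin (n + 1) => y j = 0)

lemma rawIndex_const (n : ℕ) (y : (Δ[1] : SSet.{0}) _⦋n⦌) (h : ∀ i j, y i = y j) :
    rawIndex n y = 0 := by
  unfold rawIndex
  split_ifs with h1
  · rfl
  · rcases fin_two_eq_zero_or_one (y 0) with h0 | h0
    · exact absurd (by rw [Finset.filter_true_of_mem fun i _ => (h i 0).trans h0]; simp) h1
    · rw [Finset.filter_false_of_mem fun i _ => by rw [h i 0, h0]; simp]
      simp

/-- In each degree, the simplices of the circle form a coequalizer. -/
noncomputable def circleIsCoequalizer (n : ℕ) :=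
  Limits.isColimitCoforkMapOfIsColimit
    ((evaluation SimplexCategoryᵒᵖ Type).obj (op ⦋n⦌)) circleProj_condition
    (Limits.coequalizerIsCoequalizer (SSet.stdSimplex.δ 0 : (Δ[0] : SSet.{0}) ⟶ Δ[1])
      (SSet.stdSimplex.δ 1))

/-- The invariant of the `n`-simplices of the circle that is `k` on `circleSimplex n k` for
`1 ≤ k ≤ n` and `0` on the base point. -/
noncomputable def circleIndex (n : ℕ) : SSet.S1 _⦋n⦌ ⟶ ℕ :=
  Limits.Cofork.IsColimit.desc (circleIsCoequalizer n) (TypeCat.ofHom (rawIndex n)) (by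
    ext (y : (Δ[0] : SSet.{0}) _⦋n⦌)
    refine (rawIndex_const n _ fun i j => ?_).trans (rawIndex_const n _ fun i j => ?_).symm
    · exact congrArg (SimplexCategory.δ (0 : Fin 2)).toOrderHom
        (Subsingleton.elim (α := Fin 1) (y i) (y j))
    · exact congrArg (SimplexCategory.δ (1 : Fin 2)).toOrderHom
        (Subsingleton.elim (α := Fin 1) (y i) (y j)))

lemma circleIndex_circleSimplex {n k : ℕ} (h : k ≤ n) : circleIndex n (circleSimplex n k) = k := by
  have h1 : circleIndex n (circleSimplex n k) = rawIndex n
      (SSet.stdSimplex.objEquiv.symm (SimplexCategory.Hom.mk (cut n k))) :=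
    ConcreteCategory.congr_hom (Limits.Cofork.IsColimit.π_desc' (circleIsCoequalizer n)
      (TypeCat.ofHom (rawIndex n)) _) _
  have h2 : Finset.card (Finset.univ.filter fun j : Fin (n + 1) => cut n k j = 0) = k := by
    have h3 : (Finset.univ.filter fun j : Fin (n + 1) => cut n k j = 0) =
        Finset.univ.filter fun j : Fin (n + 1) => (j : ℕ) < k := by
      refine Finset.filter_congr fun j _ => ?_
      change (if (j : ℕ) < k then (0 : Fin 2) else 1) = 0 ↔ _
      split_ifs with hj <;> simp [hj]
    rw [h3, Fin.card_filter_val_lt]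
    omega
  rw [h1]
  change (if Finset.card (Finset.univ.filter fun j : Fin (n + 1) => cut n k j = 0) = n + 1
    then 0 else Finset.card (Finset.univ.filter fun j : Fin (n + 1) => cut n k j = 0)) = k
  rw [h2, if_neg (by omega)]

lemma circleSimplex_δ {n : ℕ} (i : Fin (n + 2)) (k : ℕ) :
    SSet.S1.map (SimplexCategory.δ i).op (circleSimplex (n + 1) k) =
      circleSimplex n (if k ≤ i then k else k - 1) := by
  refine circleSimplex_map _ fun j => ?_
  change ((i.succAbove j : Fin (n + 2)) : ℕ) < k ↔ _
  rw [Fin.succAbove]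
  split_ifs with h1 h2 h2 <;> rw [Fin.lt_def] at h1 <;> simp at h1 ⊢ <;> omega

lemma circleSimplex_σ {n : ℕ} (i : Fin (n + 1)) (k : ℕ) :
    SSet.S1.map (SimplexCategory.σ i).op (circleSimplex n k) =
      circleSimplex (n + 1) (if k ≤ i then k else k + 1) := by
  refine circleSimplex_map _ fun j => ?_
  change ((i.predAbove j : Fin (n + 1)) : ℕ) < k ↔ _
  rw [Fin.predAbove]
  split_ifs with h1 h2 h2 <;> rw [Fin.lt_def] at h1 <;> simp at h1 ⊢ <;> omega

end CohenK

namespace CohenK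

/-! ### Magnus series: functions on words in the letters `1, 2, …` -/

/-- The inverse of left multiplication by `1 + y_k` on noncommutative power series, the latter
being given by their coefficients; the letter `0` stands for `y_0 = 0`. -/
def divGen (k : ℕ) (g : List ℕ → ℤ) : List ℕ → ℤ
  | [] => g []
  | j :: l => g (j :: l) - if j = k ∧ k ≠ 0 then divGen k g l else 0

/-- Left multiplication by `1 + y_k` on noncommutative power series. -/
def mulGen (k : ℕ) : Equiv.Perm (List ℕ → ℤ) where
  toFun g
    | [] => g []
    | j :: l => g (j :: l) + if j = k ∧ k ≠ 0 then g l else 0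
  invFun := divGen k
  left_inv g := by
    funext l
    induction l with
    | nil => rfl
    | cons j l ih => simp only [divGen, ih]; ring
  right_inv g := by
    funext l
    cases l with
    | nil => rfl
    | cons j l => simp only [divGen]; ring

@[simp] lemma mulGen_nil (k : ℕ) (g : List ℕ → ℤ) : mulGen k g [] = g [] := rfl

lemma mulGen_cons (k : ℕ) (g : List ℕ → ℤ) (j : ℕ) (l : List ℕ) :
    mulGen k g (j :: l) = g (j :: l) + if j = k ∧ k ≠ 0 then g l else 0 := rfl

@[simp] lemma mulGen_zero : mulGen 0 = 1 := by
  ext g l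
  cases l <;> simp [mulGen_cons]

/-- The coefficient of `mulGen k g` at a word involves only `g` at that word and at its tail, so
multiplication can be undone within any set of words closed under tails. -/
lemma mulGen_eqOn {S : Set (List ℕ)} (hS : ∀ j l, j :: l ∈ S → l ∈ S) (k : ℕ)
    {g h : List ℕ → ℤ} : Set.EqOn (mulGen k g) (mulGen k h) S ↔ Set.EqOn g h S := by
  constructor
  · intro H l
    induction l with
    | nil => exact fun hl => H hl
    | cons j l ih =>
      intro hl
      have := H hl
      rw [mulGen_cons, mulGen_cons, ih (hS j l hl)] at this
      exact add_right_cancel this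
  · intro H l hl
    cases l with
    | nil => exact H hl
    | cons j l => rw [mulGen_cons, mulGen_cons, H hl, H (hS j l hl)]

/-- The constant power series `1`. -/
def oneSeries : List ℕ → ℤ := fun l => if l = [] then 1 else 0

@[simp] lemma oneSeries_nil : oneSeries [] = 1 := rfl

@[simp] lemma oneSeries_cons (j : ℕ) (l : List ℕ) : oneSeries (j :: l) = 0 := rfl

/-- The effect on power series of the `i`-th face, which identifies the letters `i` and `i + 1`. -/
def faceSum (i : ℕ) : (List ℕ → ℤ) → List ℕ → ℤ
  | g, [] => g []
  | g, j :: l => (if j ≤ i then faceSum i (fun m => g (j :: m)) l else 0) +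
      if i ≤ j then faceSum i (fun m => g ((j + 1) :: m)) l else 0

lemma faceSum_add (i : ℕ) (g h : List ℕ → ℤ) (l : List ℕ) :
    faceSum i (fun m => g m + h m) l = faceSum i g l + faceSum i h l := by
  induction l generalizing g h with
  | nil => rfl
  | cons j l ih =>
    simp only [faceSum, ih]
    split_ifs <;> ring

lemma faceSum_zero (i : ℕ) (l : List ℕ) : faceSum i (fun _ => 0) l = 0 := by
  induction l with
  | nil => rfl
  | cons j l ih => simp [faceSum, ih]

lemma faceSum_ite (i : ℕ) (P : Prop) [Decidable P] (g : List ℕ → ℤ) (l : List ℕ) :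
    faceSum i (fun m => if P then g m else 0) l = if P then faceSum i g l else 0 := by
  split_ifs
  · rfl
  · exact faceSum_zero i l

lemma faceSum_oneSeries (i : ℕ) (l : List ℕ) : faceSum i oneSeries l = oneSeries l := by
  cases l with
  | nil => rfl
  | cons j l => simp [faceSum, faceSum_zero]

/-- The words in the letters `1, …, n`. -/
def words (n : ℕ) : Set (List ℕ) := {l | ∀ k ∈ l, 1 ≤ k ∧ k ≤ n}

lemma words_tail (n : ℕ) (j : ℕ) (l : List ℕ) (h : j :: l ∈ words n) : l ∈ words n :=
  fun k hk => h k (List.mem_cons_of_mem _ hk)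

/-- The index of the `i`-th face of `circleSimplex (n + 1) k`. -/
def faceIndex (n i k : ℕ) : ℕ :=
  if (if k ≤ i then k else k - 1) ≤ n then (if k ≤ i then k else k - 1) else 0

/-- The restriction to `words n` is essential: a face may turn `y_k` into the letter `0` or `n + 1`,
which stand for the base point and have to be ignored. -/
lemma faceSum_mulGen {n i k : ℕ} (g : List ℕ → ℤ) :
    Set.EqOn (faceSum i (mulGen k g)) (mulGen (faceIndex n i k) (faceSum i g)) (words n) := by
  intro l hl
  cases l with
  | nil => rfl
  | cons j l =>
    have hj := hl j (by simp)
    simp only [faceSum, mulGen_cons, faceSum_add, faceSum_ite]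
    unfold faceIndex
    split_ifs <;> omega

end CohenK

namespace CohenK

/-! ### Vanishing of coefficients -/

/-- The position of a letter after the identification of `i` and `i + 1`. -/
def collapse (i k : ℕ) : ℕ := if k ≤ i then k else k - 1

/-- Letters other than `i` and `i + 1` have exactly one preimage under `collapse i`, so only one
summand remains on such a prefix. -/
lemma faceSum_map_append (i : ℕ) (g : List ℕ → ℤ) (l m : List ℕ) (h : i ∉ l) (h' : i + 1 ∉ l) :
    faceSum i g (l.map (collapse i) ++ m) = faceSum i (fun m' => g (l ++ m')) m := by
  induction l generalizing g with
  | nil => rfl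
  | cons k l ih =>
    simp only [List.mem_cons, not_or] at h h'
    simp only [List.map_cons, List.cons_append, faceSum]
    rw [ih _ h.2 h'.2, ih _ h.2 h'.2]
    rcases lt_or_gt_of_ne (Ne.symm h.1) with hk | hk
    · rw [collapse, if_pos hk.le, if_pos hk.le, if_neg (by omega), add_zero]
    · rw [collapse, if_neg (by omega : ¬ k ≤ i), if_neg (by omega), if_pos (by omega), zero_add,
        Nat.sub_add_cancel (by omega)]

lemma faceSum_map (i : ℕ) (g : List ℕ → ℤ) (l : List ℕ) (h : i ∉ l) (h' : i + 1 ∉ l) :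
    faceSum i g (l.map (collapse i)) = g l := by
  have := faceSum_map_append i g l [] h h'
  simpa [faceSum] using this

lemma faceSum_map_single (i : ℕ) (g : List ℕ → ℤ) (l₁ l₂ : List ℕ) (h₁ : i ∉ l₁) (h₁' : i + 1 ∉ l₁)
    (h₂ : i ∉ l₂) (h₂' : i + 1 ∉ l₂) :
    faceSum i g (l₁.map (collapse i) ++ i :: l₂.map (collapse i)) =
      g (l₁ ++ i :: l₂) + g (l₁ ++ (i + 1) :: l₂) := by
  rw [faceSum_map_append i g l₁ _ h₁ h₁', faceSum, if_pos le_rfl, if_pos le_rfl,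
    faceSum_map _ _ _ h₂ h₂', faceSum_map _ _ _ h₂ h₂']

lemma faceSum_map_double (i : ℕ) (g : List ℕ → ℤ) (l₁ l₂ l₃ : List ℕ) (h₁ : i ∉ l₁)
    (h₁' : i + 1 ∉ l₁) (h₂ : i ∉ l₂) (h₂' : i + 1 ∉ l₂) (h₃ : i ∉ l₃) (h₃' : i + 1 ∉ l₃) :
    faceSum i g
      (l₁.map (collapse i) ++ i :: (l₂.map (collapse i) ++ i :: l₃.map (collapse i))) =
      g (l₁ ++ i :: (l₂ ++ i :: l₃)) + g (l₁ ++ i :: (l₂ ++ (i + 1) :: l₃)) +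
      (g (l₁ ++ (i + 1) :: (l₂ ++ i :: l₃)) + g (l₁ ++ (i + 1) :: (l₂ ++ (i + 1) :: l₃))) := by
  rw [faceSum_map_append i g l₁ _ h₁ h₁', faceSum, if_pos le_rfl, if_pos le_rfl,
    faceSum_map_single _ _ _ _ h₂ h₂' h₃ h₃', faceSum_map_single _ _ _ _ h₂ h₂' h₃ h₃']

lemma map_collapse_mem_words {n i : ℕ} {l : List ℕ} (hl : l ∈ words (n + 1)) (hi : i ≤ n)
    (h : i ≠ 0 ∨ 1 ∉ l) : l.map (collapse i) ∈ words n := by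
  intro k hk
  obtain ⟨k, hk', rfl⟩ := List.mem_map.1 hk
  have := hl k hk'
  unfold collapse
  rcases h with h | h
  · split_ifs <;> omega
  · have : k ≠ 1 := fun h' => h (h' ▸ hk')
    split_ifs <;> omega

lemma map_collapse_self {n : ℕ} {l : List ℕ} (hl : l ∈ words n) :
    l.map (collapse n) = l := by
  conv_rhs => rw [← List.map_id l]
  refine List.map_congr_left fun k hk => ?_
  have := hl k hk
  simp only [collapse, id]
  rw [if_pos (by omega)]

/-- A series with vanishing faces of positive index vanishes at a word missing the letter `j` and
without repetitions of larger letters. The predicate `C` is meant to be `True` or `List.Nodup`. -/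
lemma coeff_eq_zero_of_missing {n : ℕ} {g : List ℕ → ℤ} (C : List ℕ → Prop)
    (hC : ∀ (f : ℕ → ℕ) l, C l → (∀ a ∈ l, ∀ b ∈ l, f a = f b → a = b) → C (l.map f))
    (H : ∀ i, 1 ≤ i → i ≤ n + 1 → ∀ l ∈ words n, l ≠ [] → C l → faceSum i g l = 0)
    {j : ℕ} (hj : 1 ≤ j) (hjn : j ≤ n + 1) {l : List ℕ} (hl : l ∈ words (n + 1)) (h0 : l ≠ [])
    (hCl : C l) (hjl : j ∉ l) (hc : ∀ k, j < k → l.count k ≤ 1) : g l = 0 := by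
  induction hjn using Nat.decreasingInduction generalizing l with
  | self =>
    have h1 : n + 1 + 1 ∉ l := fun h => by have := hl _ h; omega
    have hl' : l ∈ words n := fun k hk => by
      have := hl k hk
      have : k ≠ n + 1 := fun h => hjl (h ▸ hk)
      omega
    have h2 := faceSum_map (n + 1) g l hjl h1
    rw [map_collapse_self hl] at h2
    rw [← h2]
    exact H _ (by omega) le_rfl l hl' h0 hCl
  | of_succ j hjn ih =>
    -- If `j + 1` occurs, it occurs once. The face `d_j` then relates the coefficient of `l` to that
    -- of the word with `j` in place of `j + 1`; this word misses `j + 1`, so the induction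
    -- hypothesis applies to it.
    by_cases h : j + 1 ∈ l
    · obtain ⟨l₁, l₂, rfl⟩ := List.append_of_mem h
      have hc1 := hc (j + 1) (by omega)
      simp only [List.count_append, List.count_cons_self] at hc1
      have h₁ : j + 1 ∉ l₁ := fun h => by have := List.count_pos_iff.2 h; omega
      have h₂ : j + 1 ∉ l₂ := fun h => by have := List.count_pos_iff.2 h; omega
      simp only [List.mem_append, List.mem_cons, not_or] at hjl
      have key := faceSum_map_single j g l₁ l₂ hjl.1 h₁ hjl.2.2 h₂
      have e1 : l₁.map (collapse j) ++ j :: l₂.map (collapse j) =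
          (l₁ ++ (j + 1) :: l₂).map (collapse j) := by simp [collapse]
      have e2 : l₁ ++ j :: l₂ = (l₁ ++ (j + 1) :: l₂).map (fun k => if k = j + 1 then j else k) := by
        simp only [List.map_append, List.map_cons, if_true]
        congr 1
        · conv_lhs => rw [← List.map_id l₁]
          refine List.map_congr_left fun k hk => (if_neg ?_).symm
          rintro rfl
          exact h₁ hk
        · congr 1
          conv_lhs => rw [← List.map_id l₂]
          refine List.map_congr_left fun k hk => (if_neg ?_).symm
          rintro rfl
          exact h₂ hk
      have hne : ∀ a ∈ l₁ ++ (j + 1) :: l₂, a ≠ j := by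
        rintro a ha rfl
        simp only [List.mem_append, List.mem_cons] at ha
        tauto
      rw [H j hj (by omega) _ (e1 ▸ map_collapse_mem_words hl (by omega) (Or.inl (by omega)))
        (by simp) (e1 ▸ hC _ _ hCl fun a ha b hb hab => by
          have := hne a ha
          have := hne b hb
          unfold collapse at hab
          split_ifs at hab <;> omega),
        ih (by omega) (l := l₁ ++ j :: l₂) (fun k hk => by
          simp only [List.mem_append, List.mem_cons] at hk
          rcases hk with hk | rfl | hk
          · exact hl k (by simp [hk])
          · omega
          · exact hl k (by simp [hk])) (by simp)
          (e2 ▸ hC _ _ hCl fun a ha b hb hab => by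
            have := hne a ha
            have := hne b hb
            split_ifs at hab <;> omega)
          (by simp [h₁, h₂]) (fun k hk => by
            have := hc k (by omega)
            rw [List.count_append, List.count_cons_of_ne (by omega)] at this ⊢
            exact this), zero_add] at key
      exact key.symm
    · exact ih (by omega) hl h0 hCl h fun k hk => hc k (by omega)

/-- The mirror image of `coeff_eq_zero_of_missing`: the induction moves upwards and starts from
`d_0`, which kills `y_1` and otherwise only shifts indices. -/
lemma coeff_eq_zero_of_missing' {n : ℕ} {g : List ℕ → ℤ}
    (H : ∀ i, i ≤ n → ∀ l ∈ words n, l ≠ [] → faceSum i g l = 0)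
    {j : ℕ} (hj : 1 ≤ j) (hjn : j ≤ n + 1) {l : List ℕ} (hl : l ∈ words (n + 1)) (h0 : l ≠ [])
    (hjl : j ∉ l) (hc : ∀ k, k < j → l.count k ≤ 1) : g l = 0 := by
  induction j, hj using Nat.le_induction generalizing l with
  | base =>
    have h1 : 0 ∉ l := fun h => by have := hl _ h; omega
    rw [← faceSum_map 0 g l h1 hjl]
    exact H 0 (by omega) _ (map_collapse_mem_words hl (by omega) (Or.inr hjl)) (by simpa using h0)
  | succ j hj ih =>
    by_cases h : j ∈ l
    · obtain ⟨l₁, l₂, rfl⟩ := List.append_of_mem h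
      have hc1 := hc j (by omega)
      simp only [List.count_append, List.count_cons_self] at hc1
      have h₁ : j ∉ l₁ := fun h => by have := List.count_pos_iff.2 h; omega
      have h₂ : j ∉ l₂ := fun h => by have := List.count_pos_iff.2 h; omega
      simp only [List.mem_append, List.mem_cons, not_or] at hjl
      have key := faceSum_map_single j g l₁ l₂ h₁ hjl.1 h₂ hjl.2.2
      have e1 : l₁.map (collapse j) ++ j :: l₂.map (collapse j) =
          (l₁ ++ j :: l₂).map (collapse j) := by simp [collapse]
      rw [H j (by omega) _ (e1 ▸ map_collapse_mem_words hl (by omega) (Or.inl (by omega)))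
        (by simp),
        ih (by omega) (l := l₁ ++ (j + 1) :: l₂) (fun k hk => by
          simp only [List.mem_append, List.mem_cons] at hk
          rcases hk with hk | rfl | hk
          · exact hl k (by simp [hk])
          · omega
          · exact hl k (by simp [hk])) (by simp)
          (by simp [h₁, h₂]) (fun k hk => by
            have := hc k (by omega)
            rw [List.count_append, List.count_cons_of_ne (by omega)] at this ⊢
            exact this), add_zero] at key
      exact key.symm
    · exact ih (by omega) hl h0 h fun k hk => hc k (by omega)

/-! ### Antisymmetry of the coefficients at permutation words -/

/-- The words in which each of the letters `1, …, n` occurs exactly once. -/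
def fullWords (n : ℕ) : Set (List ℕ) := {l | l.Perm (List.range' 1 n)}

lemma fullWords_subset_words (n : ℕ) : fullWords n ⊆ words n := fun l hl k hk => by
  have := (hl.mem_iff).1 hk
  rw [List.mem_range'_1] at this
  omega

lemma nodup_of_mem_fullWords {n : ℕ} {l : List ℕ} (h : l ∈ fullWords n) : l.Nodup :=
  h.nodup_iff.2 List.nodup_range'

lemma mem_of_mem_fullWords {n : ℕ} {l : List ℕ} (h : l ∈ fullWords n) {k : ℕ} (h1 : 1 ≤ k)
    (hk : k ≤ n) : k ∈ l :=
  h.mem_iff.2 (List.mem_range'_1.2 ⟨h1, by omega⟩)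

lemma map_swap_eq_self {a b : ℕ} {l : List ℕ} (ha : a ∉ l) (hb : b ∉ l) :
    l.map (Equiv.swap a b) = l := by
  conv_rhs => rw [← List.map_id l]
  refine List.map_congr_left fun k hk => ?_
  exact Equiv.swap_apply_of_ne_of_ne (fun h => ha (h ▸ hk)) (fun h => hb (h ▸ hk))

/-- Merging `i` and `i + 1` gives a word with `i` twice, whose coefficient in the face is a sum of
four coefficients. The two in which both places carry the same letter miss `i + 1` or `i` and
vanish, so the other two are opposite. -/
lemma coeff_map_swap_succ {n : ℕ} {g : List ℕ → ℤ}
    (H : ∀ i, i ≤ n + 1 → ∀ l ∈ words n, l ≠ [] → faceSum i g l = 0)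
    {i : ℕ} (hi : 1 ≤ i) (hin : i ≤ n) {l : List ℕ} (hl : l ∈ fullWords (n + 1)) :
    g (l.map (Equiv.swap i (i + 1))) = - g l := by
  have key : ∀ l₁ l₂ l₃ : List ℕ, ∀ a b, (a = i ∧ b = i + 1 ∨ a = i + 1 ∧ b = i) →
      l₁ ++ a :: (l₂ ++ b :: l₃) ∈ fullWords (n + 1) →
      g ((l₁ ++ a :: (l₂ ++ b :: l₃)).map (Equiv.swap i (i + 1))) =
        - g (l₁ ++ a :: (l₂ ++ b :: l₃)) := by
    intro l₁ l₂ l₃ a b hab hl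
    have hw := fullWords_subset_words _ hl
    have hnd := nodup_of_mem_fullWords hl
    have hmem : i ∉ l₁ ∧ i + 1 ∉ l₁ ∧ i ∉ l₂ ∧ i + 1 ∉ l₂ ∧ i ∉ l₃ ∧ i + 1 ∉ l₃ := by
      simp only [List.nodup_append, List.nodup_cons, List.mem_append, List.mem_cons, not_or] at hnd
      obtain ⟨-, ⟨⟨h1, h2, h3⟩, -, ⟨h4, -⟩, h5⟩, h6⟩ := hnd
      have ha1 : a ∉ l₁ := fun h => h6 a h a (Or.inl rfl) rfl
      have hb1 : b ∉ l₁ := fun h => h6 b h b (Or.inr (Or.inr (Or.inl rfl))) rfl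
      have hb2 : b ∉ l₂ := fun h => h5 b h b (Or.inl rfl) rfl
      rcases hab with ⟨rfl, rfl⟩ | ⟨rfl, rfl⟩ <;> tauto
    obtain ⟨h₁, h₁', h₂, h₂', h₃, h₃'⟩ := hmem
    have hcount : ∀ k, (l₁ ++ a :: (l₂ ++ b :: l₃)).count k ≤ 1 := List.nodup_iff_count_le_one.1 hnd
    have dbl : ∀ c, (c = i ∨ c = i + 1) → ∀ k, k ≠ i → k ≠ i + 1 →
        (l₁ ++ c :: (l₂ ++ c :: l₃)).count k ≤ 1 := by
      intro c hcc k hk hk'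
      have := hcount k
      simp only [List.count_append] at this ⊢
      rw [List.count_cons_of_ne (by omega), List.count_append,
        List.count_cons_of_ne (by omega)] at this ⊢
      exact this
    have dblw : ∀ c, (c = i ∨ c = i + 1) → l₁ ++ c :: (l₂ ++ c :: l₃) ∈ words (n + 1) := by
      intro c hcc k hk
      simp only [List.mem_append, List.mem_cons] at hk
      rcases hk with hk | rfl | hk | rfl | hk
      · exact hw k (by simp [hk])
      · omega
      · exact hw k (by simp [hk])
      · omega
      · exact hw k (by simp [hk])
    have z1 : g (l₁ ++ i :: (l₂ ++ i :: l₃)) = 0 :=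
      coeff_eq_zero_of_missing (fun _ => True) (fun _ _ _ _ => trivial)
        (fun i _ hi l hl h0 _ => H i hi l hl h0) (j := i + 1) (by omega) (by omega)
        (dblw i (Or.inl rfl)) (by simp) trivial (by simp [h₁', h₂', h₃'])
        (fun k hk => dbl i (Or.inl rfl) k (by omega) (by omega))
    have z2 : g (l₁ ++ (i + 1) :: (l₂ ++ (i + 1) :: l₃)) = 0 :=
      coeff_eq_zero_of_missing' (fun i hi => H i (by omega)) (j := i) (by omega) (by omega)
        (dblw (i + 1) (Or.inr rfl)) (by simp) (by simp [h₁, h₂, h₃])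
        (fun k hk => dbl (i + 1) (Or.inr rfl) k (by omega) (by omega))
    have e := faceSum_map_double i g l₁ l₂ l₃ h₁ h₁' h₂ h₂' h₃ h₃'
    have e1 : l₁.map (collapse i) ++ i :: (l₂.map (collapse i) ++ i :: l₃.map (collapse i)) =
        (l₁ ++ a :: (l₂ ++ b :: l₃)).map (collapse i) := by
      rcases hab with ⟨rfl, rfl⟩ | ⟨rfl, rfl⟩ <;> simp [collapse]
    rw [H i (by omega) _ (e1 ▸ map_collapse_mem_words hw hin (Or.inl (by omega))) (by simp),
      z1, z2, zero_add, add_zero] at e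
    simp only [List.map_append, List.map_cons, map_swap_eq_self h₁ h₁', map_swap_eq_self h₂ h₂',
      map_swap_eq_self h₃ h₃']
    rcases hab with ⟨rfl, rfl⟩ | ⟨rfl, rfl⟩
    · rw [Equiv.swap_apply_left, Equiv.swap_apply_right]
      linarith
    · rw [Equiv.swap_apply_left, Equiv.swap_apply_right]
      linarith
  obtain ⟨l₁, m, rfl⟩ := List.append_of_mem (mem_of_mem_fullWords hl hi (by omega))
  have h2 := mem_of_mem_fullWords hl (k := i + 1) (by omega) (by omega)
  simp only [List.mem_append, List.mem_cons] at h2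
  rcases h2 with h2 | h2 | h2
  · obtain ⟨l₁, l₂, rfl⟩ := List.append_of_mem h2
    have := key l₁ l₂ m (i + 1) i (Or.inr ⟨rfl, rfl⟩) (by simpa using hl)
    simpa using this
  · omega
  · obtain ⟨l₂, l₃, rfl⟩ := List.append_of_mem h2
    exact key l₁ l₂ l₃ i (i + 1) (Or.inl ⟨rfl, rfl⟩) hl

lemma map_swap_mem_fullWords {n a b : ℕ} {l : List ℕ} (hl : l ∈ fullWords n) (ha : 1 ≤ a)
    (han : a ≤ n) (hb : 1 ≤ b) (hbn : b ≤ n) : l.map (Equiv.swap a b) ∈ fullWords n := by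
  refine (List.perm_ext_iff_of_nodup ((nodup_of_mem_fullWords hl).map (Equiv.injective _))
    List.nodup_range').2 fun k => ?_
  rw [List.mem_map, ← hl.mem_iff]
  constructor
  · rintro ⟨j, hj, rfl⟩
    rw [Equiv.swap_apply_def]
    split_ifs
    · exact mem_of_mem_fullWords hl hb hbn
    · exact mem_of_mem_fullWords hl ha han
    · exact hj
  · intro hk
    refine ⟨Equiv.swap a b k, ?_, Equiv.swap_apply_self _ _ _⟩
    rw [Equiv.swap_apply_def]
    split_ifs
    · exact mem_of_mem_fullWords hl hb hbn
    · exact mem_of_mem_fullWords hl ha han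
    · exact hk

lemma coeff_map_swap {n : ℕ} {g : List ℕ → ℤ}
    (H : ∀ i, 1 ≤ i → i < n → ∀ l ∈ fullWords n, g (l.map (Equiv.swap i (i + 1))) = - g l)
    {a b : ℕ} (ha : 1 ≤ a) (hab : a < b) (hb : b ≤ n) {l : List ℕ} (hl : l ∈ fullWords n) :
    g (l.map (Equiv.swap a b)) = - g l := by
  induction b, (show a + 1 ≤ b from hab) using Nat.le_induction generalizing l with
  | base => exact H a ha (by omega) l hl
  | succ b hab' ih =>
    -- The transposition `(a, b+1)` is the conjugate of `(a, b)` by `(b, b+1)`, a product of three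
    -- sign changes.
    have e : l.map (Equiv.swap a (b + 1)) = ((l.map (Equiv.swap b (b + 1))).map
        (Equiv.swap a b)).map (Equiv.swap b (b + 1)) := by
      rw [List.map_map, List.map_map, ← Equiv.Perm.coe_mul, ← Equiv.Perm.coe_mul,
        Equiv.swap_mul_swap_mul_swap (by omega) (by omega), Equiv.swap_comm]
    have m1 := map_swap_mem_fullWords hl (a := b) (b := b + 1) (by omega) (by omega) (by omega) hb
    have m2 := map_swap_mem_fullWords m1 (a := a) (b := b) (by omega) (by omega) (by omega)
      (by omega)
    rw [e, H b (by omega) (by omega) _ m2, ih (by omega) (by omega) m1,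
      H b (by omega) (by omega) _ hl, neg_neg]

/-- In a word without repetitions, exchanging two places is the same as exchanging the two values
there. -/
lemma coeff_swap_adjacent {n : ℕ} {g : List ℕ → ℤ}
    (H : ∀ i, 1 ≤ i → i < n → ∀ l ∈ fullWords n, g (l.map (Equiv.swap i (i + 1))) = - g l)
    {a b : ℕ} {l₁ l₂ : List ℕ} (hl : l₁ ++ a :: b :: l₂ ∈ fullWords n) :
    g (l₁ ++ b :: a :: l₂) = - g (l₁ ++ a :: b :: l₂) := by
  have hw := fullWords_subset_words _ hl
  have hnd := nodup_of_mem_fullWords hl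
  have hmem : a ∉ l₁ ∧ b ∉ l₁ ∧ a ∉ l₂ ∧ b ∉ l₂ ∧ a ≠ b := by
    simp only [List.nodup_append, List.nodup_cons, List.mem_cons, not_or] at hnd
    obtain ⟨-, ⟨⟨h1, h2⟩, h3, -⟩, h6⟩ := hnd
    have ha1 : a ∉ l₁ := fun h => h6 a h a (Or.inl rfl) rfl
    have hb1 : b ∉ l₁ := fun h => h6 b h b (Or.inr (Or.inl rfl)) rfl
    tauto
  obtain ⟨h₁, h₁', h₂, h₂', hne⟩ := hmem
  have e : (l₁ ++ a :: b :: l₂).map (Equiv.swap a b) = l₁ ++ b :: a :: l₂ := by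
    simp [map_swap_eq_self h₁ h₁', map_swap_eq_self h₂ h₂']
  have ha := hw a (by simp)
  have hb := hw b (by simp)
  rw [← e]
  rcases lt_or_gt_of_ne hne with h | h
  · exact coeff_map_swap H ha.1 h hb.2 hl
  · rw [Equiv.swap_comm]
    exact coeff_map_swap H hb.1 h ha.2 hl

/-! ### Shuffles -/

/-- The sum of the coefficients over all shuffles of two words. -/
def shuffleSum : (List ℕ → ℤ) → List ℕ → List ℕ → ℤ
  | g, [], J => g J
  | g, i :: I, [] => g (i :: I)
  | g, i :: I, j :: J =>
    shuffleSum (fun m => g (i :: m)) I (j :: J) + shuffleSum (fun m => g (j :: m)) (i :: I) J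
termination_by _ I J => I.length + J.length

@[simp] lemma shuffleSum_nil_left (g : List ℕ → ℤ) (J : List ℕ) : shuffleSum g [] J = g J := by
  rw [shuffleSum]

@[simp] lemma shuffleSum_nil_right (g : List ℕ → ℤ) (I : List ℕ) : shuffleSum g I [] = g I := by
  cases I <;> rw [shuffleSum]

lemma shuffleSum_cons_cons (g : List ℕ → ℤ) (i j : ℕ) (I J : List ℕ) :
    shuffleSum g (i :: I) (j :: J) = shuffleSum (fun m => g (i :: m)) I (j :: J) +
      shuffleSum (fun m => g (j :: m)) (i :: I) J := by
  rw [shuffleSum]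

lemma shuffleSum_add_ite (P : Prop) [Decidable P] (g h : List ℕ → ℤ) (I J : List ℕ) :
    shuffleSum (fun m => g m + if P then h m else 0) I J =
      shuffleSum g I J + if P then shuffleSum h I J else 0 := by
  induction hn : I.length + J.length using Nat.strong_induction_on generalizing g h I J with
  | _ n ih =>
    subst hn
    rcases I with _ | ⟨i, I⟩
    · simp
    rcases J with _ | ⟨j, J⟩
    · simp
    simp only [shuffleSum_cons_cons]
    rw [ih _ (by simp) _ _ _ _ rfl, ih _ (by simp) _ _ _ _ rfl]
    split_ifs <;> ring

lemma shuffleSum_mulGen (k : ℕ) (g : List ℕ → ℤ) (i j : ℕ) (I J : List ℕ) :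
    shuffleSum (mulGen k g) (i :: I) (j :: J) = shuffleSum g (i :: I) (j :: J) +
      (if i = k ∧ k ≠ 0 then shuffleSum g I (j :: J) else 0) +
      (if j = k ∧ k ≠ 0 then shuffleSum g (i :: I) J else 0) := by
  simp only [shuffleSum_cons_cons, mulGen_cons, shuffleSum_add_ite]
  ring

/-- The coefficients of a group-like series: the shuffle relations for disjoint words. -/
def GroupLike (g : List ℕ → ℤ) : Prop :=
  g [] = 1 ∧ ∀ I J : List ℕ, I.Disjoint J → shuffleSum g I J = g I * g J

/-- The factor `1 + y_k` is not an exponential, so shuffle relations are available only for disjoint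
words. There `k` can be the first letter of at most one of the two words, and the term in which it
would be split off from both never appears. -/
lemma groupLike_mulGen_iff (k : ℕ) (g : List ℕ → ℤ) : GroupLike (mulGen k g) ↔ GroupLike g := by
  constructor
  · rintro ⟨h0, h⟩
    rw [mulGen_nil] at h0
    refine ⟨h0, fun I J hIJ => ?_⟩
    induction hn : I.length + J.length using Nat.strong_induction_on generalizing I J with
    | _ n ih =>
      subst hn
      rcases I with _ | ⟨i, I⟩
      · simp [h0]
      rcases J with _ | ⟨j, J⟩
      · simp [h0]
      have h1 := h _ _ hIJ
      simp only [List.disjoint_cons_left, List.disjoint_cons_right, List.mem_cons, not_or] at hIJ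
      rw [shuffleSum_mulGen, ih _ (by simp) I (j :: J) (by
        simp only [List.disjoint_cons_right]; tauto) rfl, ih _ (by simp) (i :: I) J (by
        simp only [List.disjoint_cons_left]; tauto) rfl, mulGen_cons, mulGen_cons] at h1
      have hij : i ≠ j := by tauto
      split_ifs at h1 with hi hj hj
      · exact absurd (hi.1.trans hj.1.symm) hij
      all_goals linarith
  · rintro ⟨h0, h⟩
    refine ⟨h0, fun I J hIJ => ?_⟩
    rcases I with _ | ⟨i, I⟩
    · simp [h0]
    rcases J with _ | ⟨j, J⟩
    · simp [h0]
    have hIJ' := hIJ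
    simp only [List.disjoint_cons_left, List.disjoint_cons_right, List.mem_cons, not_or] at hIJ'
    rw [shuffleSum_mulGen, h _ _ hIJ, h I (j :: J) (by
        simp only [List.disjoint_cons_right]; tauto), h (i :: I) J (by
        simp only [List.disjoint_cons_left]; tauto), mulGen_cons, mulGen_cons]
    have hij : i ≠ j := by tauto
    split_ifs with hi hj hj
    · exact absurd (hi.1.trans hj.1.symm) hij
    all_goals ring

lemma groupLike_oneSeries : GroupLike oneSeries := by
  have h0 : ∀ I J : List ℕ, shuffleSum (fun _ => 0) I J = 0 := by
    intro I J
    have := shuffleSum_add_ite False (fun _ => 0) (fun _ => 0) I J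
    induction hn : I.length + J.length using Nat.strong_induction_on generalizing I J with
    | _ n ih =>
      subst hn
      rcases I with _ | ⟨i, I⟩
      · simp
      rcases J with _ | ⟨j, J⟩
      · simp
      rw [shuffleSum_cons_cons, ih _ (by simp) _ _ (by simp) rfl,
        ih _ (by simp) _ _ (by simp) rfl, add_zero]
  refine ⟨rfl, fun I J _ => ?_⟩
  rcases I with _ | ⟨i, I⟩
  · simp
  rcases J with _ | ⟨j, J⟩
  · simp
  simp [shuffleSum_cons_cons, h0]

/-- Moving `a` through `J` gives `J.length + 1` terms with alternating signs, whose sum is `1` or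
`0` times the leading one. The prefix `u` is there to make the induction work. -/
lemma shuffleSum_singleton {n : ℕ} {g : List ℕ → ℤ}
    (H : ∀ (l₁ l₂ : List ℕ) (a b : ℕ), l₁ ++ a :: b :: l₂ ∈ fullWords n →
      g (l₁ ++ b :: a :: l₂) = - g (l₁ ++ a :: b :: l₂)) (a : ℕ) (J u : List ℕ)
    (hl : u ++ a :: J ∈ fullWords n) :
    shuffleSum (fun m => g (u ++ m)) [a] J = if Even J.length then g (u ++ a :: J) else 0 := by
  induction J generalizing u with
  | nil => simp
  | cons j J ih =>
    have hp : u ++ j :: a :: J ∈ fullWords n :=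
      (List.Perm.append_left u (List.Perm.swap a j J)).trans hl
    have h1 := ih (u ++ [j]) (by simpa using hp)
    simp only [List.append_assoc, List.cons_append, List.nil_append] at h1
    rw [shuffleSum_cons_cons, h1, H _ _ _ _ hl]
    simp only [shuffleSum_nil_left, List.length_cons, Nat.even_add_one]
    split_ifs <;> ring

/-- This is the signed count of shuffles, the value at `-1` of a Gaussian binomial coefficient. Two
letters are used because the count for a single letter can be `0`, whereas this one is always
positive. -/
lemma shuffleSum_pair {n : ℕ} {g : List ℕ → ℤ}
    (H : ∀ (l₁ l₂ : List ℕ) (a b : ℕ), l₁ ++ a :: b :: l₂ ∈ fullWords n →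
      g (l₁ ++ b :: a :: l₂) = - g (l₁ ++ a :: b :: l₂)) (a b : ℕ) (J u : List ℕ)
    (hl : u ++ a :: b :: J ∈ fullWords n) :
    shuffleSum (fun m => g (u ++ m)) [a, b] J =
      ((J.length / 2 + 1 : ℕ) : ℤ) * g (u ++ a :: b :: J) := by
  induction J generalizing u with
  | nil => simp
  | cons j J ih =>
    have hp1 : u ++ a :: j :: b :: J ∈ fullWords n :=
      (List.Perm.append_left u (List.Perm.cons a (List.Perm.swap b j J))).trans hl
    have hp : u ++ j :: a :: b :: J ∈ fullWords n :=
      (List.Perm.append_left u (List.Perm.swap a j _)).trans hp1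
    have h1 := ih (u ++ [j]) (by simpa using hp)
    have h2 := shuffleSum_singleton H b (j :: J) (u ++ [a]) (by simpa using hl)
    have h3 := H (u ++ [a]) J b j (by simpa using hl)
    simp only [List.append_assoc, List.cons_append, List.nil_append] at h1 h2 h3
    rw [shuffleSum_cons_cons, h1, h2, H _ _ _ _ hp1, h3, neg_neg]
    simp only [List.length_cons]
    split_ifs with he
    · have : (J.length + 1) / 2 = J.length / 2 + 1 := by
        obtain ⟨r, hr⟩ := he; omega
      rw [this]
      push_cast
      ring
    · have : (J.length + 1) / 2 = J.length / 2 := by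
        rw [Nat.not_even_iff_odd] at he
        obtain ⟨r, hr⟩ := he; omega
      rw [this]
      ring

/-- A group-like series all of whose faces are trivial has no coefficients at the words in which
each of the letters `1, …, n` occurs exactly once, if `n > 2`. -/
lemma coeff_fullWords_eq_zero {n : ℕ} (hn : 2 ≤ n) {g : List ℕ → ℤ} (hg : GroupLike g)
    (H : ∀ i, i ≤ n + 1 → ∀ l ∈ words n, l ≠ [] → faceSum i g l = 0) {l : List ℕ}
    (hl : l ∈ fullWords (n + 1)) : g l = 0 := by
  have hlen : l.length = n + 1 := by rw [hl.length_eq, List.length_range']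
  obtain ⟨a, b, c, J, rfl⟩ : ∃ a b c J, l = a :: b :: c :: J := by
    match l, hlen with
    | a :: b :: c :: J, _ => exact ⟨a, b, c, J, rfl⟩
    | [_, _], h => simp at h; omega
    | [_], h => simp at h; omega
    | [], h => simp at h
  have hw := fullWords_subset_words _ hl
  have hnd := nodup_of_mem_fullWords hl
  have hnd' := hnd
  simp only [List.nodup_cons, List.mem_cons, not_or] at hnd'
  have h1 := shuffleSum_pair (g := g) (n := n + 1) (fun l₁ l₂ a b h => coeff_swap_adjacent
    (fun i hi hin l hl => coeff_map_swap_succ H hi (by omega) hl) h) a b (c :: J) [] hl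
  have h2 := hg.2 [a, b] (c :: J) (by
    simp only [List.disjoint_cons_left, List.mem_cons]
    simp
    tauto)
  have hc := hw c (by simp)
  -- The third letter `c` is missing from `[a, b]`; this is where at least three letters are needed.
  have h3 : g [a, b] = 0 := by
    refine coeff_eq_zero_of_missing (fun _ => True) (fun _ _ _ _ => trivial)
      (fun i _ hi l hl h0 _ => H i hi l hl h0) hc.1 hc.2
      (fun k hk => hw k (by simp at hk ⊢; tauto)) (by simp) trivial
      (by simp; tauto) (fun k _ => List.nodup_iff_count_le_one.1 (by simp; tauto) k)
  simp only [List.nil_append] at h1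
  rw [h2, h3, zero_mul] at h1
  rcases mul_eq_zero.1 h1.symm with h | h
  · exact absurd h (by positivity)
  · exact h

end CohenK

namespace CohenK

open scoped commutatorElement

/-! ### Multilinear noncommutative power series -/

/-- Left multiplication by the letter `k` on multilinear noncommutative power series, in which words
with repeated letters are `0`; the letter `0` stands for `0`. -/
def letter (k : ℕ) : Module.End ℤ (List ℕ → ℤ) where
  toFun g
    | [] => 0
    | j :: l => if j = k ∧ k ≠ 0 ∧ k ∉ l then g l else 0
  map_add' g h := by
    funext l
    cases l with
    | nil => rfl
    | cons j l =>
      simp only [Pi.add_apply]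
      split_ifs <;> rfl
  map_smul' c g := by
    funext l
    cases l with
    | nil => simp
    | cons j l =>
      simp only [Pi.smul_apply, smul_eq_mul, RingHom.id_apply]
      split_ifs <;> simp

@[simp] lemma letter_apply_nil (k : ℕ) (g : List ℕ → ℤ) : letter k g [] = 0 := rfl

lemma letter_apply_cons (k : ℕ) (g : List ℕ → ℤ) (j : ℕ) (l : List ℕ) :
    letter k g (j :: l) = if j = k ∧ k ≠ 0 ∧ k ∉ l then g l else 0 := rfl

@[simp] lemma letter_zero : letter 0 = 0 := by
  ext g l
  cases l <;> simp [letter_apply_cons]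

/-- An operator on multilinear series that behaves like multiplication by a series all of whose
monomials involve the letter `i`. -/
def Involves (i : ℕ) (a : Module.End ℤ (List ℕ → ℤ)) : Prop :=
  (∀ g l, i ∉ l → a g l = 0) ∧ ∀ g : List ℕ → ℤ, (∀ l, i ∉ l → g l = 0) → a g = 0

lemma Involves.letter (i : ℕ) : Involves i (letter i) := by
  constructor
  · intro g l hl
    cases l with
    | nil => rfl
    | cons j l =>
      rw [letter_apply_cons, if_neg]
      rintro ⟨rfl, -⟩
      simp at hl
  · intro g hg
    funext l
    cases l with
    | nil => rfl
    | cons j l =>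
      rw [letter_apply_cons]
      split_ifs with h
      · exact hg l h.2.2
      · rfl

lemma Involves.mul_letter {i : ℕ} {a : Module.End ℤ (List ℕ → ℤ)} (h : Involves i a) (j : ℕ) :
    Involves i (a * CohenK.letter j) := by
  refine ⟨fun g l hl => h.1 _ l hl, fun g hg => h.2 _ fun l hl => ?_⟩
  cases l with
  | nil => rfl
  | cons k l =>
    simp only [List.mem_cons, not_or] at hl
    rw [letter_apply_cons, hg l hl.2, ite_self]

lemma Involves.letter_mul {i : ℕ} {a : Module.End ℤ (List ℕ → ℤ)} (h : Involves i a) (j : ℕ) :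
    Involves i (CohenK.letter j * a) := by
  constructor
  · intro g l hl
    cases l with
    | nil => rfl
    | cons k l =>
      simp only [List.mem_cons, not_or] at hl
      rw [Module.End.mul_apply, letter_apply_cons, h.1 g l hl.2, ite_self]
  · intro g hg
    rw [Module.End.mul_apply, h.2 g hg, map_zero]

lemma Involves.add {i : ℕ} {a b : Module.End ℤ (List ℕ → ℤ)} (ha : Involves i a)
    (hb : Involves i b) : Involves i (a + b) :=
  ⟨fun g l hl => by rw [LinearMap.add_apply, Pi.add_apply, ha.1 g l hl, hb.1 g l hl, add_zero],
    fun g hg => by rw [LinearMap.add_apply, ha.2 g hg, hb.2 g hg, add_zero]⟩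

lemma Involves.neg {i : ℕ} {a : Module.End ℤ (List ℕ → ℤ)} (ha : Involves i a) :
    Involves i (-a) :=
  ⟨fun g l hl => by rw [LinearMap.neg_apply, Pi.neg_apply, ha.1 g l hl, neg_zero],
    fun g hg => by rw [LinearMap.neg_apply, ha.2 g hg, neg_zero]⟩

lemma Involves.zero (i : ℕ) : Involves i 0 := ⟨fun _ _ _ => rfl, fun _ _ => rfl⟩

/-- Every value of `b` is supported on words containing `i`, and `a` kills such series: this is
multilinearity. -/
lemma Involves.mul_eq_zero {i : ℕ} {a b : Module.End ℤ (List ℕ → ℤ)} (ha : Involves i a)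
    (hb : Involves i b) : a * b = 0 :=
  LinearMap.ext fun g => ha.2 _ fun l hl => hb.1 g l hl

/-- The left-normed bracket of letters. -/
def letterBracket (k : ℕ) (l : List ℕ) : Module.End ℤ (List ℕ → ℤ) :=
  l.foldl (fun a j => ⁅a, letter j⁆) (letter k)

lemma letterBracket_nil (k : ℕ) : letterBracket k [] = letter k := rfl

lemma letterBracket_append (k : ℕ) (l : List ℕ) (j : ℕ) :
    letterBracket k (l ++ [j]) = letterBracket k l * letter j - letter j * letterBracket k l := by
  rw [letterBracket, List.foldl_append]
  rfl

/-- The operator `b` is generalized because expanding the last bracket moves a letter to the other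
side of it. -/
lemma Involves.mul_letterBracket {i : ℕ} (k : ℕ) (l : List ℕ) {b : Module.End ℤ (List ℕ → ℤ)}
    (hb : Involves i b) :
    Involves i (letterBracket k l * b) ∧ Involves i (b * letterBracket k l) := by
  induction l using List.reverseRecOn generalizing b with
  | nil => exact ⟨hb.letter_mul k, hb.mul_letter k⟩
  | append_singleton l j ih =>
    rw [letterBracket_append, sub_mul, mul_sub, sub_eq_add_neg, sub_eq_add_neg, mul_assoc,
      mul_assoc, ← mul_assoc b, ← mul_assoc b]
    exact ⟨(ih (hb.letter_mul j)).1.add ((ih hb).1.letter_mul j).neg,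
      ((ih hb).2.mul_letter j).add (ih (hb.mul_letter j)).2.neg⟩

lemma involves_letterBracket {i k : ℕ} {l : List ℕ} (h : i ∈ k :: l) :
    Involves i (letterBracket k l) := by
  induction l using List.reverseRecOn with
  | nil =>
    obtain rfl : i = k := by simpa using h
    exact Involves.letter i
  | append_singleton l j ih =>
    rw [letterBracket_append, sub_eq_add_neg]
    by_cases h' : i ∈ k :: l
    · exact ((ih h').mul_letter j).add ((ih h').letter_mul j).neg
    · obtain rfl : i = j := by
        rw [← List.cons_append, List.mem_append] at h
        simpa using h.resolve_left h'
      exact ((Involves.letter i).mul_letterBracket k l).1.add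
        ((Involves.letter i).mul_letterBracket k l).2.neg

lemma letterBracket_eq_zero {k : ℕ} {l : List ℕ} (h : ¬ (k :: l).Nodup) :
    letterBracket k l = 0 := by
  induction l using List.reverseRecOn with
  | nil => simp at h
  | append_singleton l j ih =>
    rw [letterBracket_append]
    by_cases h' : (k :: l).Nodup
    · have hj : j ∈ k :: l := by
        rw [← List.cons_append, List.nodup_append] at h
        by_contra hj
        exact h ⟨h', by simp, fun a ha b hb hab => by
          rw [List.mem_singleton] at hb
          exact hj (hb ▸ hab ▸ ha)⟩
      rw [(involves_letterBracket hj).mul_eq_zero (Involves.letter j),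
        (Involves.letter j).mul_eq_zero (involves_letterBracket hj), sub_zero]
    · rw [ih h', zero_mul, mul_zero, sub_zero]

/-- When the bracket is expanded, every term except `y_k y_{l_1} ⋯ y_{l_t}` has some `y_j` with `j ≠
k` in front and does not contribute to words starting with `k`. -/
lemma letterBracket_apply_cons {k : ℕ} (hk : k ≠ 0) {l : List ℕ} (hl : ∀ j ∈ l, j ≠ 0 ∧ j ≠ k)
    (hn : l.Nodup) (g : List ℕ → ℤ) (l' : List ℕ) (hk' : k ∉ l') (hn' : l'.Nodup) :
    letterBracket k l g (k :: l') = if l <+: l' then g (l'.drop l.length) else 0 := by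
  induction l using List.reverseRecOn generalizing g with
  | nil => simp [letterBracket_nil, letter_apply_cons, hk, hk']
  | append_singleton l j ih =>
    have hj := hl j (by simp)
    have hn2 : l.Nodup := hn.of_append_left
    rw [letterBracket_append, LinearMap.sub_apply, Pi.sub_apply, Module.End.mul_apply,
      Module.End.mul_apply, letter_apply_cons j _ k, if_neg (by rintro ⟨rfl, -⟩; exact hj.2 rfl),
      sub_zero, ih (fun i hi => hl i (by simp [hi])) hn2]
    by_cases h : l <+: l'
    · obtain ⟨m, rfl⟩ := h
      rw [if_pos (List.prefix_append _ _), List.drop_left]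
      rcases m with _ | ⟨i, m⟩
      · rw [if_neg, letter_apply_nil]
        intro h
        have := h.length_le
        simp at this
      · have him : i ∉ m := by
          have := hn'.of_append_right
          simp at this
          exact this.1
        rw [letter_apply_cons]
        by_cases hij : i = j
        · subst hij
          rw [if_pos ⟨rfl, hj.1, him⟩, if_pos ⟨m, by simp⟩]
          simp
        · rw [if_neg (by tauto), if_neg]
          rw [List.prefix_append_right_inj]
          intro h
          rw [List.cons_prefix_cons] at h
          exact hij h.1.symm
    · rw [if_neg h, if_neg fun h' => h ((List.prefix_append _ _).trans h')]

lemma letterBracket_oneSeries {k : ℕ} (hk : k ≠ 0) {l : List ℕ} (hl : ∀ j ∈ l, j ≠ 0 ∧ j ≠ k)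
    (hn : l.Nodup) (l' : List ℕ) (hk' : k ∉ l') (hn' : l'.Nodup) :
    letterBracket k l oneSeries (k :: l') = if l = l' then 1 else 0 := by
  rw [letterBracket_apply_cons hk hl hn _ _ hk' hn']
  by_cases h : l <+: l'
  · obtain ⟨m, rfl⟩ := h
    rw [if_pos (List.prefix_append _ _), List.drop_left]
    simp [oneSeries]
  · rw [if_neg h, if_neg]
    rintro rfl
    exact h (List.prefix_refl _)

/-- The unit `1 + y_k`. -/
def letterUnit (k : ℕ) : (Module.End ℤ (List ℕ → ℤ))ˣ where
  val := 1 + letter k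
  inv := 1 - letter k
  val_inv := by
    have := (Involves.letter k).mul_eq_zero (Involves.letter k)
    simp [mul_sub, add_mul, this]
  inv_val := by
    have := (Involves.letter k).mul_eq_zero (Involves.letter k)
    simp [mul_add, sub_mul, this]

lemma val_letterUnit (k : ℕ) : (letterUnit k : Module.End ℤ (List ℕ → ℤ)) = 1 + letter k := rfl

lemma letterUnit_zero : letterUnit 0 = 1 := Units.ext (by simp [val_letterUnit])

lemma leftCommutator_append {A : Type u} [Group A] (g : A) (l : List A) (a : A) :
    leftCommutator g (l ++ [a]) = ⁅leftCommutator g l, a⁆ := by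
  rw [leftCommutator, List.foldl_append]
  rfl

lemma val_leftCommutator_letterUnit (k : ℕ) (l : List ℕ) :
    ((leftCommutator (letterUnit k) (l.map letterUnit) : (Module.End ℤ (List ℕ → ℤ))ˣ) :
      Module.End ℤ (List ℕ → ℤ)) =
      1 + letterBracket k l := by
  induction l using List.reverseRecOn with
  | nil => rfl
  | append_singleton l j ih =>
    have hb : Involves k (letterBracket k l) := involves_letterBracket (by simp)
    have hy := Involves.letter j
    have h1 := hb.mul_eq_zero hb
    have h2 := hy.mul_eq_zero hy
    have h3 := hb.mul_eq_zero (hb.letter_mul j)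
    have h4 := hy.mul_eq_zero (hy.mul_letterBracket k l).1
    rw [List.map_append, List.map_singleton, leftCommutator_append, commutatorElement_def,
      letterBracket_append]
    set c := leftCommutator (letterUnit k) (l.map letterUnit)
    set b := letterBracket k l
    set y := letter j
    -- With `c = 1 + b`, the claim `[c, 1 + y] = 1 + (by - yb)` amounts to this identity; the two
    -- sides differ by terms in which `b` or `y` occurs twice, and these vanish.
    have e : (c * letterUnit j : Module.End ℤ (List ℕ → ℤ)) =
        (1 + (b * y - y * b)) * (letterUnit j * c) := by
      rw [val_letterUnit, ih]
      have : (1 + b) * (1 + y) - (1 + (b * y - y * b)) * ((1 + y) * (1 + b)) =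
          y * (b * b) + y * (b * (y * b)) + y * (b * y) - b * (y * b) - b * (y * y) * (1 + b)
          := by noncomm_ring
      rw [← sub_eq_zero, this, h1, h2, h3, h4]
      simp
    rw [Units.val_mul, Units.val_mul, Units.val_mul, e, mul_assoc, mul_assoc, mul_assoc,
      ← mul_assoc (c : Module.End ℤ (List ℕ → ℤ)), Units.mul_inv, one_mul, Units.mul_inv, mul_one]

lemma leftCommutator_letterUnit_eq_one {k : ℕ} {l : List ℕ} (h : ¬ (k :: l).Nodup) :
    leftCommutator (letterUnit k) (l.map letterUnit) = 1 :=
  Units.ext (by rw [val_leftCommutator_letterUnit, letterBracket_eq_zero h, add_zero]; rfl)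

lemma mulGen_eqOn_letterUnit (k : ℕ) {g h : List ℕ → ℤ} (H : Set.EqOn g h {l | l.Nodup}) :
    Set.EqOn (mulGen k g) ((letterUnit k : Module.End ℤ (List ℕ → ℤ)) h) {l | l.Nodup} := by
  intro l hl
  rw [val_letterUnit, LinearMap.add_apply, Pi.add_apply]
  cases l with
  | nil => rw [letter_apply_nil, mulGen_nil, add_zero]; exact H hl
  | cons j l =>
    have hl' := hl
    rw [Set.mem_ofPred_eq, List.nodup_cons] at hl
    rw [letter_apply_cons, mulGen_cons, H hl', H hl.2, Module.End.one_apply]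
    congr 1
    refine if_congr ?_ rfl rfl
    constructor
    · rintro ⟨rfl, h⟩
      exact ⟨rfl, h, hl.1⟩
    · tauto

/-! ### Groups without repeated commutators -/

section Commutators

variable {A : Type u} [Group A] {ι : Type*} (x : ι → A)

/-- The subgroup generated by the left-normed commutators starting with a fixed generator. -/
def commutatorsFrom (a : ι) : Subgroup A :=
  Subgroup.closure (Set.range fun l : List ι => leftCommutator (x a) (l.map x))

lemma leftCommutator_mem_commutatorsFrom (a : ι) (l : List ι) :
    leftCommutator (x a) (l.map x) ∈ commutatorsFrom x a :=
  Subgroup.subset_closure ⟨l, rfl⟩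

variable {x}

/-- Conjugating a commutator `c` by `x_j` gives `[c, x_j]⁻¹ c`. For conjugation by `x_j⁻¹` the
repetition in `[[c, x_j], x_j]` shows that `[c, x_j]` commutes with `x_j`, and the result is `[c,
x_j] c`. -/
lemma commutatorsFrom_normal (hgen : Subgroup.closure (Set.range x) = ⊤)
    (hrep : ∀ i l, ¬ (i :: l).Nodup → leftCommutator (x i) (l.map x) = 1) (a : ι) :
    (commutatorsFrom x a).Normal := by
  have hc : ∀ l j, leftCommutator (x a) ((l ++ [j]).map x) =
      ⁅leftCommutator (x a) (l.map x), x j⁆ := fun l j => by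
    rw [List.map_append, List.map_singleton, leftCommutator_append]
  have key : ∀ g : A, (∀ h ∈ commutatorsFrom x a, g * h * g⁻¹ ∈ commutatorsFrom x a) ∧
      ∀ h ∈ commutatorsFrom x a, g⁻¹ * h * g ∈ commutatorsFrom x a := by
    intro g
    have hg : g ∈ Subgroup.closure (Set.range x) := hgen ▸ Subgroup.mem_top g
    induction hg using Subgroup.closure_induction with
    | mem g hg =>
      obtain ⟨j, rfl⟩ := hg
      have hcomm : ∀ l, ⁅leftCommutator (x a) ((l ++ [j]).map x), x j⁆ = 1 := fun l => by
        rw [← hc]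
        exact hrep _ _ (by simp [List.nodup_append])
      constructor
      · intro h hh
        induction hh using Subgroup.closure_induction with
        | mem h hh =>
          obtain ⟨l, rfl⟩ := hh
          have : x j * leftCommutator (x a) (l.map x) * (x j)⁻¹ =
              (leftCommutator (x a) ((l ++ [j]).map x))⁻¹ * leftCommutator (x a) (l.map x) := by
            rw [hc, commutatorElement_def]
            group
          dsimp only
          rw [this]
          exact mul_mem (inv_mem (leftCommutator_mem_commutatorsFrom x a _))
            (leftCommutator_mem_commutatorsFrom x a _)
        | one => simp
        | mul h h' _ _ ih ih' => simpa [mul_assoc] using mul_mem ih ih'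
        | inv h _ ih => simpa [mul_assoc] using inv_mem ih
      · intro h hh
        induction hh using Subgroup.closure_induction with
        | mem h hh =>
          obtain ⟨l, rfl⟩ := hh
          have h1 := hcomm l
          rw [commutatorElement_eq_one_iff_mul_comm] at h1
          have : (x j)⁻¹ * leftCommutator (x a) (l.map x) * x j =
              leftCommutator (x a) ((l ++ [j]).map x) * leftCommutator (x a) (l.map x) := by
            rw [mul_assoc, inv_mul_eq_iff_eq_mul, ← mul_assoc, ← h1, hc, commutatorElement_def]
            group
          dsimp only
          rw [this]
          exact mul_mem (leftCommutator_mem_commutatorsFrom x a _)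
            (leftCommutator_mem_commutatorsFrom x a _)
        | one => simp
        | mul h h' _ _ ih ih' => simpa [mul_assoc] using mul_mem ih ih'
        | inv h _ ih => simpa [mul_assoc] using inv_mem ih
    | one => simp
    | mul g g' _ _ ih ih' =>
      refine ⟨fun h hh => ?_, fun h hh => ?_⟩
      · simpa [mul_assoc] using ih.1 _ (ih'.1 h hh)
      · simpa [mul_assoc] using ih'.2 _ (ih.2 h hh)
    | inv g _ ih => exact ⟨fun h hh => by simpa using ih.2 h hh, fun h hh => by simpa using ih.1 h hh⟩
  exact ⟨fun h hh g => (key g).1 h hh⟩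

/-- The generator `x a` centralizes the subgroup, since bracketing once more with `x a` repeats it.
The centralizer of a normal subgroup is normal, so it also contains every commutator starting with
`x a`. -/
lemma commutatorsFrom_commute (hgen : Subgroup.closure (Set.range x) = ⊤)
    (hrep : ∀ i l, ¬ (i :: l).Nodup → leftCommutator (x i) (l.map x) = 1) (a : ι)
    {g h : A} (hg : g ∈ commutatorsFrom x a) (hh : h ∈ commutatorsFrom x a) : g * h = h * g := by
  have hN := commutatorsFrom_normal hgen hrep a
  have hle : commutatorsFrom x a ≤ Subgroup.centralizer (commutatorsFrom x a) := by
    conv_lhs => rw [commutatorsFrom]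
    rw [Subgroup.closure_le]
    rintro _ ⟨l, rfl⟩
    induction l using List.reverseRecOn with
    | nil =>
      refine Subgroup.mem_centralizer_iff.2 fun h hh => ?_
      induction hh using Subgroup.closure_induction with
      | mem h hh =>
        obtain ⟨l, rfl⟩ := hh
        have := hrep a (l ++ [a]) (by simp)
        rw [List.map_append, List.map_singleton, leftCommutator_append,
          commutatorElement_eq_one_iff_mul_comm] at this
        exact this
      | one => simp
      | mul h h' _ _ ih ih' => exact (Commute.mul_left (show Commute h _ from ih) ih')
      | inv h _ ih => exact (Commute.inv_left (show Commute h _ from ih))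
    | append_singleton l j ih =>
      dsimp only at ih ⊢
      rw [List.map_append, List.map_singleton, leftCommutator_append, commutatorElement_def,
        mul_assoc, mul_assoc, ← mul_assoc (x j)]
      exact mul_mem ih ((inferInstance : (Subgroup.centralizer
        (commutatorsFrom x a : Set A)).Normal).conj_mem _ (inv_mem ih) _)
  exact (Subgroup.mem_centralizer_iff.1 (hle hh) g hg)

end Commutators

/-! ### Left-normed brackets in Lie rings -/

section Brackets

variable {L : Type} [LieRing L] {ι : Type} (x : ι → L)

/-- The left-normed bracket of elements of a family. -/
def leftBracket (i : ι) (l : List ι) : L := l.foldl (fun b j => ⁅b, x j⁆) (x i)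

lemma leftBracket_append (i : ι) (l : List ι) (j : ι) :
    leftBracket x i (l ++ [j]) = ⁅leftBracket x i l, x j⁆ := by
  rw [leftBracket, List.foldl_append]
  rfl

/-- The span of the left-normed brackets of weight `w` starting with a generator in `s`. -/
def leftBracketSpan (s : Set ι) (w : ℕ) : Submodule ℤ L :=
  Submodule.span ℤ {a | ∃ i ∈ s, ∃ l : List ι, l.length + 1 = w ∧ a = leftBracket x i l}

lemma lie_gen_mem_leftBracketSpan {s : Set ι} {w : ℕ} {a : L} (ha : a ∈ leftBracketSpan x s w)
    (j : ι) : ⁅a, x j⁆ ∈ leftBracketSpan x s (w + 1) := by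
  induction ha using Submodule.span_induction with
  | mem a ha =>
    obtain ⟨i, hi, l, hl, rfl⟩ := ha
    rw [← leftBracket_append]
    exact Submodule.subset_span ⟨i, hi, _, by simpa using hl, rfl⟩
  | zero => rw [zero_lie]; exact zero_mem _
  | add a b _ _ iha ihb => rw [add_lie]; exact add_mem iha ihb
  | smul c a _ ih => rw [zsmul_lie]; exact Submodule.smul_mem _ c ih

/-- The Jacobi identity in the form `[a, [b, x]] = [[a, b], x] - [[a, x], b]` reduces the length of
the right factor. -/
lemma lie_leftBracket_mem {s : Set ι} {w : ℕ} {a : L} (ha : a ∈ leftBracketSpan x s w)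
    (i : ι) (l : List ι) : ⁅a, leftBracket x i l⁆ ∈ leftBracketSpan x s (w + (l.length + 1)) := by
  induction l using List.reverseRecOn generalizing a w with
  | nil => exact lie_gen_mem_leftBracketSpan x ha i
  | append_singleton l j ih =>
    have h1 := lie_gen_mem_leftBracketSpan x (ih ha) j
    have h2 := ih (lie_gen_mem_leftBracketSpan x ha j)
    have e : ⁅a, leftBracket x i (l ++ [j])⁆ =
        ⁅⁅a, leftBracket x i l⁆, x j⁆ - ⁅⁅a, x j⁆, leftBracket x i l⁆ := by
      rw [leftBracket_append, leibniz_lie a, ← lie_skew (⁅a, x j⁆) (leftBracket x i l)]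
      abel
    rw [e]
    refine sub_mem ?_ ?_
    · simpa [add_assoc] using h1
    · convert h2 using 1
      simp
      ring_nf

lemma lie_mem_leftBracketSpan {s t : Set ι} {w v : ℕ} {a b : L} (ha : a ∈ leftBracketSpan x s w)
    (hb : b ∈ leftBracketSpan x t v) : ⁅a, b⁆ ∈ leftBracketSpan x s (w + v) := by
  induction hb using Submodule.span_induction with
  | mem b hb =>
    obtain ⟨i, hi, l, rfl, rfl⟩ := hb
    exact lie_leftBracket_mem x ha i l
  | zero => rw [lie_zero]; exact zero_mem _
  | add b b' _ _ ih ih' => rw [lie_add]; exact add_mem ih ih'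
  | smul c b _ ih => rw [lie_zsmul]; exact Submodule.smul_mem _ c ih

lemma IsBracket.mem_leftBracketSpan {w : ℕ} {a : L} (h : IsBracket x w a) :
    a ∈ leftBracketSpan x Set.univ w := by
  induction h with
  | gen i => exact Submodule.subset_span ⟨i, trivial, [], rfl, rfl⟩
  | lie _ _ iha ihb => exact lie_mem_leftBracketSpan x iha ihb

lemma isBracket_leftBracket (i : ι) (l : List ι) :
    IsBracket x (l.length + 1) (leftBracket x i l) := by
  induction l using List.reverseRecOn with
  | nil => exact IsBracket.gen i
  | append_singleton l j ih =>
    rw [leftBracket_append, List.length_append]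
    exact IsBracket.lie ih (IsBracket.gen j)

/-- Where `a` enters as `[b, x_a]`, it is moved to the front by antisymmetry; the Jacobi identity
makes the result left-normed again. -/
lemma leftBracket_mem_of_mem {a i : ι} {l : List ι} (h : a ∈ i :: l) :
    leftBracket x i l ∈ leftBracketSpan x {a} (l.length + 1) := by
  induction l using List.reverseRecOn with
  | nil =>
    obtain rfl : a = i := by simpa using h
    exact Submodule.subset_span ⟨a, rfl, [], rfl, rfl⟩
  | append_singleton l j ih =>
    rw [leftBracket_append, List.length_append]
    by_cases h' : a ∈ i :: l
    · exact lie_gen_mem_leftBracketSpan x (ih h') j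
    · obtain rfl : a = j := by
        rw [← List.cons_append, List.mem_append] at h
        simpa using h.resolve_left h'
      rw [← lie_skew, neg_mem_iff]
      have : x a ∈ leftBracketSpan x {a} 1 := Submodule.subset_span ⟨a, rfl, [], rfl, rfl⟩
      convert lie_leftBracket_mem x this i l using 1
      simp
      ring_nf

end Brackets

end CohenK

namespace CohenK

open CategoryTheory Opposite
open scoped commutatorElement

/-! ### Simplices of `F(S¹)` and `K(S¹)` -/

/-- The group of `n`-simplices of `F(S¹)`. -/
abbrev FGrp (n : ℕ) : Type := MilnorGrp SSet.S1 circlePt (op (.mk n))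

/-- The group of `n`-simplices of `K(S¹)`. -/
abbrev KGrp (n : ℕ) : Type := CohenGrp SSet.S1 circlePt (op (.mk n))

/-- The projection `F(S¹)_n → K(S¹)_n`. -/
noncomputable abbrev toK (n : ℕ) : FGrp n →* KGrp n :=
  QuotientGroup.mk' (Subgroup.normalClosure (repeatedCommutators SSet.S1 circlePt (op (.mk n))))

/-- The generators `x_k` of `F(S¹)_n`. -/
noncomputable def genF (n k : ℕ) : FGrp n := milnorOf SSet.S1 circlePt _ (circleSimplex n k)

/-- The generators `x_k` of `K(S¹)_n`. -/
noncomputable def genK (n k : ℕ) : KGrp n := toK n (genF n k)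

/-- The faces of `F(S¹)`. -/
noncomputable abbrev faceF (n : ℕ) (i : Fin (n + 2)) : FGrp (n + 1) →* FGrp n :=
  milnorMap SSet.S1 circlePt (SimplexCategory.δ i).op

/-- The degeneracies of `F(S¹)`. -/
noncomputable abbrev degF (n : ℕ) (i : Fin (n + 1)) : FGrp n →* FGrp (n + 1) :=
  milnorMap SSet.S1 circlePt (SimplexCategory.σ i).op

/-- The faces of `K(S¹)`. -/
noncomputable abbrev faceK (n : ℕ) (i : Fin (n + 2)) : KGrp (n + 1) →* KGrp n :=
  cohenMap SSet.S1 circlePt (SimplexCategory.δ i).op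

/-- The degeneracies of `K(S¹)`. -/
noncomputable abbrev degK (n : ℕ) (i : Fin (n + 1)) : KGrp n →* KGrp (n + 1) :=
  cohenMap SSet.S1 circlePt (SimplexCategory.σ i).op

lemma faceK_toK (n : ℕ) (i : Fin (n + 2)) (w : FGrp (n + 1)) :
    faceK n i (toK (n + 1) w) = toK n (faceF n i w) := rfl

lemma genF_eq_one {n k : ℕ} (h : k = 0 ∨ n < k) : genF n k = 1 := by
  rw [genF, circleSimplex_eq_basePt h]
  exact (QuotientGroup.eq_one_iff _).2 (Subgroup.subset_normalClosure rfl)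

lemma genK_eq_one {n k : ℕ} (h : k = 0 ∨ n < k) : genK n k = 1 := by
  rw [genK, genF_eq_one h, map_one]

lemma faceF_genF (n : ℕ) (i : Fin (n + 2)) (k : ℕ) :
    faceF n i (genF (n + 1) k) = genF n (collapse i k) :=
  (milnorMap_of _ _ _ _).trans (congrArg _ (circleSimplex_δ i k))

lemma degF_genF (n : ℕ) (i : Fin (n + 1)) (k : ℕ) :
    degF n i (genF n k) = genF (n + 1) (if k ≤ i then k else k + 1) :=
  (milnorMap_of _ _ _ _).trans (congrArg _ (circleSimplex_σ i k))

lemma faceK_genK (n : ℕ) (i : Fin (n + 2)) (k : ℕ) :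
    faceK n i (genK (n + 1) k) = genK n (collapse i k) :=
  congrArg (toK n) (faceF_genF n i k)

lemma degK_genK (n : ℕ) (i : Fin (n + 1)) (k : ℕ) :
    degK n i (genK n k) = genK (n + 1) (if k ≤ i then k else k + 1) :=
  congrArg (toK (n + 1)) (degF_genF n i k)

lemma closure_genF (n : ℕ) : Subgroup.closure (Set.range fun k : Fin (n + 1) => genF n k) = ⊤ := by
  rw [eq_top_iff]
  rintro w -
  induction w using QuotientGroup.induction_on with
  | H w =>
    induction w using FreeGroup.induction_on with
    | C1 => exact one_mem _
    | of x =>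
      obtain ⟨k, hk, rfl⟩ := exists_circleSimplex_eq n x
      exact Subgroup.subset_closure ⟨⟨k, by omega⟩, rfl⟩
    | inv_of x ih => exact inv_mem ih
    | mul x y ihx ihy => exact mul_mem ihx ihy

lemma fGrp_induction {n : ℕ} {p : FGrp n → Prop} (gen : ∀ k ≤ n, p (genF n k)) (one : p 1)
    (mul : ∀ x y, p x → p y → p (x * y)) (inv : ∀ x, p x → p x⁻¹) (w : FGrp n) : p w := by
  have hw : w ∈ Subgroup.closure (Set.range fun k : Fin (n + 1) => genF n k) :=
    closure_genF n ▸ Subgroup.mem_top w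
  induction hw using Subgroup.closure_induction with
  | mem x hx =>
    obtain ⟨k, rfl⟩ := hx
    exact gen k (by omega)
  | one => exact one
  | mul x y _ _ hx hy => exact mul x y hx hy
  | inv x _ hx => exact inv x hx

lemma toK_surjective (n : ℕ) : Function.Surjective (toK n) := QuotientGroup.mk'_surjective _

lemma closure_genK (n : ℕ) : Subgroup.closure (Set.range (genK n)) = ⊤ := by
  rw [eq_top_iff]
  rintro w -
  obtain ⟨w, rfl⟩ := toK_surjective n w
  induction w using fGrp_induction with
  | gen k hk => exact Subgroup.subset_closure ⟨k, rfl⟩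
  | one => rw [map_one]; exact one_mem _
  | mul x y hx hy => rw [map_mul]; exact mul_mem hx hy
  | inv x hx => rw [map_inv]; exact inv_mem hx

lemma leftCommutator_genK_eq_one (n i : ℕ) (l : List ℕ) (h : ¬ (i :: l).Nodup) :
    leftCommutator (genK n i) (l.map (genK n)) = 1 := by
  have h1 : leftCommutator (genK n i) (l.map (genK n)) =
      toK n (leftCommutator (genF n i) (l.map (genF n))) := by
    rw [map_leftCommutator, List.map_map]
    rfl
  rw [h1]
  refine (QuotientGroup.eq_one_iff _).2 (Subgroup.subset_normalClosure
    ⟨circleSimplex n i, l.map (circleSimplex n), fun h' => h ?_, ?_⟩)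
  · exact List.Nodup.of_map (circleSimplex n) (by simpa using h')
  · rw [List.map_map]
    rfl

lemma leftCommutator_eq_one_of_mem {A : Type u} [Group A] {g : A} {l : List A}
    (h : (1 : A) ∈ g :: l) : leftCommutator g l = 1 := by
  induction l using List.reverseRecOn with
  | nil => exact (List.mem_singleton.1 h).symm
  | append_singleton l a ih =>
    rw [leftCommutator_append]
    by_cases h' : (1 : A) ∈ g :: l
    · rw [ih h', commutatorElement_one_left]
    · have : (1 : A) = a := by
        rw [← List.cons_append, List.mem_append] at h
        simpa using h.resolve_left h'
      rw [← this, commutatorElement_one_right]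

/-! ### The Magnus expansion of `F(S¹)` and the multilinear expansion of `K(S¹)` -/

lemma circleIndex_basePt (n : ℕ) : circleIndex n (basePt SSet.S1 circlePt (op (.mk n))) = 0 := by
  rw [← circleSimplex_eq_basePt (Or.inl rfl), circleIndex_circleSimplex (Nat.zero_le n)]

/-- The action of `F(S¹)_n` on power series by `x_k ↦ 1 + y_k`. -/
noncomputable def magnus (n : ℕ) : FGrp n →* Equiv.Perm (List ℕ → ℤ) :=
  QuotientGroup.lift _ (FreeGroup.lift fun s => mulGen (circleIndex n s))
    (Subgroup.normalClosure_le_normal (N := MonoidHom.ker _) (by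
      rintro _ rfl
      rw [SetLike.mem_coe, MonoidHom.mem_ker, FreeGroup.lift_apply_of, circleIndex_basePt,
        mulGen_zero]))

lemma magnus_genF {n k : ℕ} (hk : k ≤ n) : magnus n (genF n k) = mulGen k := by
  have : magnus n (genF n k) = mulGen (circleIndex n (circleSimplex n k)) :=
    FreeGroup.lift_apply_of
  rw [this, circleIndex_circleSimplex hk]

/-- The action of `F(S¹)_n` on multilinear power series by `x_k ↦ 1 + y_k`. -/
noncomputable def multilinearF (n : ℕ) : FGrp n →* (Module.End ℤ (List ℕ → ℤ))ˣ :=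
  QuotientGroup.lift _ (FreeGroup.lift fun s => letterUnit (circleIndex n s))
    (Subgroup.normalClosure_le_normal (N := MonoidHom.ker _) (by
      rintro _ rfl
      rw [SetLike.mem_coe, MonoidHom.mem_ker, FreeGroup.lift_apply_of, circleIndex_basePt,
        letterUnit_zero]))

/-- The action of `K(S¹)_n` on multilinear power series by `x_k ↦ 1 + y_k`. -/
noncomputable def multilinear (n : ℕ) : KGrp n →* (Module.End ℤ (List ℕ → ℤ))ˣ :=
  QuotientGroup.lift _ (multilinearF n)
    (Subgroup.normalClosure_le_normal (N := MonoidHom.ker _) (by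
      rintro _ ⟨x, l, hl, rfl⟩
      have h : ∀ s, multilinearF n (milnorOf SSet.S1 circlePt _ s) =
          letterUnit (circleIndex n s) := fun s => FreeGroup.lift_apply_of
      rw [SetLike.mem_coe, MonoidHom.mem_ker, map_leftCommutator, List.map_map, h]
      have h2 := leftCommutator_letterUnit_eq_one (k := circleIndex n x)
        (l := l.map (circleIndex n)) fun h' => hl (List.Nodup.of_map (circleIndex n)
          (by simpa using h'))
      rw [List.map_map] at h2
      rw [← h2]
      congr 1))

lemma multilinear_genK {n k : ℕ} (hk : k ≤ n) : multilinear n (genK n k) = letterUnit k := by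
  have : multilinear n (genK n k) = letterUnit (circleIndex n (circleSimplex n k)) :=
    FreeGroup.lift_apply_of
  rw [this, circleIndex_circleSimplex hk]

/-- Both expansions have the same coefficients at words without repetitions. The equivalence over
arbitrary `g` and `h` makes inverses accessible: it can be applied to the already inverted series
and the factors cancel. `magnus_faceF` and `groupLike_magnus` have this form for the same reason. -/
lemma magnus_eqOn_multilinear {n : ℕ} (w : FGrp n) {g h : List ℕ → ℤ} :
    Set.EqOn (magnus n w g) ((multilinear n (toK n w) : Module.End ℤ (List ℕ → ℤ)) h)
      {l | l.Nodup} ↔ Set.EqOn g h {l | l.Nodup} := by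
  induction w using fGrp_induction generalizing g h with
  | gen k hk =>
    rw [magnus_genF hk, ← genK, multilinear_genK hk]
    refine ⟨fun H => ?_, mulGen_eqOn_letterUnit k⟩
    rw [← mulGen_eqOn (S := {l | l.Nodup}) (fun j l hl => (List.nodup_cons.1 hl).2) k]
    exact H.trans (mulGen_eqOn_letterUnit k fun _ _ => rfl).symm
  | one => simp
  | mul x y hx hy =>
    rw [map_mul, map_mul, map_mul, Units.val_mul]
    exact hx.trans hy
  | inv x hx =>
    rw [← hx, map_inv, map_inv, map_inv, ← Equiv.Perm.mul_apply, mul_inv_cancel,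
      ← Module.End.mul_apply, Units.mul_inv]
    rfl

lemma magnus_faceF {n : ℕ} (i : Fin (n + 2)) (w : FGrp (n + 1)) {g h : List ℕ → ℤ} :
    Set.EqOn (magnus n (faceF n i w) h) (faceSum i (magnus (n + 1) w g)) (words n) ↔
      Set.EqOn h (faceSum i g) (words n) := by
  induction w using fGrp_induction generalizing g h with
  | gen k hk =>
    have e : magnus n (faceF n i (genF (n + 1) k)) = mulGen (faceIndex n i k) := by
      rw [faceF_genF, faceIndex, collapse]
      split_ifs with h1 h2 h2
      · exact magnus_genF h2
      · rw [genF_eq_one (Or.inr (by omega)), map_one, mulGen_zero]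
      · exact magnus_genF h2
      · rw [genF_eq_one (Or.inr (by omega)), map_one, mulGen_zero]
    rw [e, magnus_genF hk]
    refine Iff.trans ?_ (mulGen_eqOn (words_tail n) (faceIndex n i k))
    exact ⟨fun H => H.trans (faceSum_mulGen g), fun H => H.trans (faceSum_mulGen g).symm⟩
  | one => simp
  | mul x y hx hy =>
    rw [map_mul, map_mul, map_mul]
    exact hx.trans hy
  | inv x hx =>
    rw [← hx, map_inv, map_inv, map_inv, ← Equiv.Perm.mul_apply, mul_inv_cancel,
      ← Equiv.Perm.mul_apply, mul_inv_cancel]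
    rfl

/-- The coefficient of a word in the expansion of an element of `K(S¹)_n`. -/
noncomputable def coeffK (n : ℕ) (w : KGrp n) (l : List ℕ) : ℤ :=
  (multilinear n w : Module.End ℤ (List ℕ → ℤ)) oneSeries l

lemma magnus_oneSeries_eq {n : ℕ} (w : FGrp n) {l : List ℕ} (hl : l.Nodup) :
    magnus n w oneSeries l = coeffK n (toK n w) l :=
  (magnus_eqOn_multilinear w).2 (fun _ _ => rfl) hl

lemma faceSum_magnus_oneSeries {n : ℕ} (i : Fin (n + 2)) (w : FGrp (n + 1)) {l : List ℕ}
    (hl : l ∈ words n) :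
    faceSum i (magnus (n + 1) w oneSeries) l = magnus n (faceF n i w) oneSeries l :=
  ((magnus_faceF i w).2 (fun l _ => (faceSum_oneSeries i l).symm) hl).symm

lemma groupLike_magnus {n : ℕ} (w : FGrp n) {g : List ℕ → ℤ} :
    GroupLike (magnus n w g) ↔ GroupLike g := by
  induction w using fGrp_induction generalizing g with
  | gen k hk => rw [magnus_genF hk, groupLike_mulGen_iff]
  | one => simp
  | mul x y hx hy =>
    rw [map_mul]
    exact hx.trans hy
  | inv x hx =>
    rw [← hx, map_inv, ← Equiv.Perm.mul_apply, mul_inv_cancel]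
    rfl

lemma coeffK_one_of_ne_nil {n : ℕ} {l : List ℕ} (hl : l ≠ []) : coeffK n 1 l = 0 := by
  simp [coeffK, oneSeries, hl]

lemma mem_fullWords_of_nodup {n : ℕ} {l : List ℕ} (hl : l ∈ words n) (hn : l.Nodup)
    (h : ∀ j, 1 ≤ j → j ≤ n → j ∈ l) : l ∈ fullWords n :=
  (List.perm_ext_iff_of_nodup hn List.nodup_range').2 fun k => by
    rw [List.mem_range'_1]
    exact ⟨fun hk => by have := hl k hk; omega, fun hk => h k hk.1 (by omega)⟩

lemma cons_mem_fullWords_iff {n : ℕ} {l : List ℕ} :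
    (n + 1) :: l ∈ fullWords (n + 1) ↔ l ∈ fullWords n := by
  have h : (List.range' 1 (n + 1)).Perm ((n + 1) :: List.range' 1 n) := by
    rw [List.range'_1_concat, add_comm 1 n]
    exact List.perm_append_comm
  exact ⟨fun h' => List.Perm.cons_inv (h'.trans h), fun h' => (List.Perm.cons _ h').trans h.symm⟩

/-- The coefficients of an element of `K(S¹)` with trivial faces of positive index vanish at words
missing a letter. -/
lemma coeffK_eq_zero {n : ℕ} {w : KGrp (n + 1)} (hw : ∀ i : Fin (n + 2), i ≠ 0 → faceK n i w = 1)
    {l : List ℕ} (hl : l ∈ words (n + 1)) (h0 : l ≠ []) (hn : l.Nodup)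
    (hf : l ∉ fullWords (n + 1)) : coeffK (n + 1) w l = 0 := by
  obtain ⟨w, rfl⟩ := toK_surjective _ w
  obtain ⟨j, hj, hjn, hjl⟩ : ∃ j, 1 ≤ j ∧ j ≤ n + 1 ∧ j ∉ l := by
    by_contra! h
    exact hf (mem_fullWords_of_nodup hl hn h)
  rw [← magnus_oneSeries_eq w hn]
  -- The faces are trivial only in `K(S¹)`, so the face of the lifted series is known to vanish only
  -- at words without repetitions; hence the choice of predicate.
  refine coeff_eq_zero_of_missing List.Nodup (fun f l hl h => hl.map_on h) (fun i hi hin l hl h0 hn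
    => ?_) hj hjn hl h0 hn hjl fun k _ => List.nodup_iff_count_le_one.1 hn k
  have := faceSum_magnus_oneSeries (⟨i, by omega⟩ : Fin (n + 2)) w hl
  rw [magnus_oneSeries_eq _ hn, ← faceK_toK, hw _ (by rw [Ne, Fin.ext_iff]; simp; omega),
    coeffK_one_of_ne_nil h0] at this
  exact this

lemma coeffK_toK_eq_zero {n : ℕ} (h2 : 2 ≤ n) {w : FGrp (n + 1)} (hw : ∀ i, faceF n i w = 1)
    {l : List ℕ} (hl : l ∈ fullWords (n + 1)) : coeffK (n + 1) (toK (n + 1) w) l = 0 := by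
  rw [← magnus_oneSeries_eq w (nodup_of_mem_fullWords hl)]
  refine coeff_fullWords_eq_zero h2 ((groupLike_magnus w).2 groupLike_oneSeries)
    (fun i hi l hl h0 => ?_) hl
  have := faceSum_magnus_oneSeries (⟨i, by omega⟩ : Fin (n + 2)) w hl
  rw [hw, map_one] at this
  rw [this]
  simp [oneSeries, h0]

/-! ### The structure of `K(S¹)` -/

/-- The commutators `[[…[x_{n+1}, x_{l₁}], …], x_{l_t}]`. -/
noncomputable def topCommutator (n : ℕ) (l : List ℕ) : KGrp (n + 1) :=
  leftCommutator (genK (n + 1) (n + 1)) (l.map (genK (n + 1)))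

/-- The subgroup generated by all commutators starting with `x_{n+1}`. -/
noncomputable abbrev topSubgroup (n : ℕ) : Subgroup (KGrp (n + 1)) :=
  commutatorsFrom (genK (n + 1)) (n + 1)

/-- The subgroup generated by the commutators starting with `x_{n+1}` and involving each of
`x_1, …, x_n` once. -/
noncomputable def fullSubgroup (n : ℕ) : Subgroup (KGrp (n + 1)) :=
  Subgroup.closure (topCommutator n '' fullWords n)

lemma fullSubgroup_le (n : ℕ) : fullSubgroup n ≤ topSubgroup n := by
  rw [fullSubgroup, Subgroup.closure_le]
  rintro _ ⟨l, -, rfl⟩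
  exact leftCommutator_mem_commutatorsFrom _ _ _

lemma topSubgroup_normal (n : ℕ) : (topSubgroup n).Normal :=
  commutatorsFrom_normal (closure_genK _) (leftCommutator_genK_eq_one _) _

/-- Modulo the normal subgroup containing `x_{n+1}`, an element is unchanged by the last face
followed by the last degeneracy, as is seen on generators. -/
lemma mem_topSubgroup {n : ℕ} {w : KGrp (n + 1)} (h : faceK n (Fin.last (n + 1)) w = 1) :
    w ∈ topSubgroup n := by
  have hN := topSubgroup_normal n
  have key : ∀ w : KGrp (n + 1), w⁻¹ * degK n (Fin.last n) (faceK n (Fin.last (n + 1)) w) ∈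
      topSubgroup n := by
    intro w
    rw [← QuotientGroup.eq]
    have hw : w ∈ Subgroup.closure (Set.range (genK (n + 1))) := closure_genK _ ▸ Subgroup.mem_top w
    induction hw using Subgroup.closure_induction with
    | mem x hx =>
      obtain ⟨k, rfl⟩ := hx
      rw [faceK_genK, degK_genK, Fin.val_last, Fin.val_last]
      rcases lt_trichotomy k (n + 1) with hk | rfl | hk
      · rw [collapse, if_pos hk.le, if_pos (by omega)]
      · rw [collapse, if_pos le_rfl, if_neg (by omega),
          genK_eq_one (n := n + 1) (k := n + 1 + 1) (Or.inr (by omega)), QuotientGroup.mk_one, QuotientGroup.eq_one_iff]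
        exact leftCommutator_mem_commutatorsFrom (genK (n + 1)) (n + 1) []
      · rw [genK_eq_one (Or.inr hk), genK_eq_one]
        right
        unfold collapse
        split_ifs <;> omega
    | one => simp
    | mul x y _ _ hx hy => rw [map_mul, map_mul, QuotientGroup.mk_mul, QuotientGroup.mk_mul, hx, hy]
    | inv x _ hx => rw [map_inv, map_inv, QuotientGroup.mk_inv, QuotientGroup.mk_inv, hx]
  have := key w
  rw [h, map_one, mul_one] at this
  exact inv_mem_iff.1 this

lemma multilinear_topCommutator {n : ℕ} {l : List ℕ} (hl : l ∈ words n) :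
    (multilinear (n + 1) (topCommutator n l) : Module.End ℤ (List ℕ → ℤ)) =
      1 + letterBracket (n + 1) l := by
  rw [topCommutator, map_leftCommutator, List.map_map, multilinear_genK le_rfl,
    ← val_leftCommutator_letterUnit]
  congr 2
  refine List.map_congr_left fun k hk => multilinear_genK ?_
  have := hl k hk
  omega

lemma topCommutator_eq_one {n : ℕ} {l : List ℕ} (h : ¬ (l ∈ words n ∧ l.Nodup)) :
    topCommutator n l = 1 := by
  by_cases hn : ((n + 1) :: l).Nodup
  · rw [List.nodup_cons] at hn
    have : ∃ k ∈ l, ¬ (1 ≤ k ∧ k ≤ n) := by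
      by_contra! h'
      exact h ⟨h', hn.2⟩
    obtain ⟨k, hk, hkn⟩ := this
    have hk1 : k ≠ n + 1 := fun h => hn.1 (h ▸ hk)
    refine leftCommutator_eq_one_of_mem (List.mem_cons_of_mem _ (List.mem_map.2 ⟨k, hk, ?_⟩))
    exact genK_eq_one (by omega)
  · exact leftCommutator_genK_eq_one _ _ _ hn

/-- For operators `1 + a` and `1 + b` with `a` and `b` involving `n + 1`, the product is `1 + a +
b`. Therefore coefficients at nonempty words are additive on `topSubgroup n`. -/
lemma involves_of_mem_topSubgroup {n : ℕ} {w : KGrp (n + 1)} (h : w ∈ topSubgroup n) :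
    Involves (n + 1) ((multilinear (n + 1) w : Module.End ℤ (List ℕ → ℤ)) - 1) := by
  induction h using Subgroup.closure_induction with
  | mem x hx =>
    obtain ⟨l, rfl⟩ := hx
    change Involves (n + 1)
      ((multilinear (n + 1) (topCommutator n l) : Module.End ℤ (List ℕ → ℤ)) - 1)
    by_cases hl : l ∈ words n
    · rw [multilinear_topCommutator hl, add_sub_cancel_left]
      exact involves_letterBracket (by simp)
    · rw [topCommutator_eq_one (by tauto), map_one, Units.val_one, sub_self]
      exact Involves.zero _
  | one =>
    rw [map_one, Units.val_one, sub_self]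
    exact Involves.zero _
  | mul x y _ _ hx hy =>
    have h := hx.mul_eq_zero hy
    have : (multilinear (n + 1) (x * y) : Module.End ℤ (List ℕ → ℤ)) - 1 =
        (multilinear (n + 1) x - 1) + (multilinear (n + 1) y - 1) := by
      rw [map_mul, Units.val_mul]
      rw [← sub_eq_zero, ← h]
      noncomm_ring
    rw [this]
    exact hx.add hy
  | inv x _ hx =>
    have h := hx.mul_eq_zero hx
    have : (multilinear (n + 1) x⁻¹ : Module.End ℤ (List ℕ → ℤ)) - 1 =
        - (multilinear (n + 1) x - 1) := by
      rw [map_inv]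
      have h2 : ((multilinear (n + 1) x)⁻¹ : (Module.End ℤ (List ℕ → ℤ))ˣ) *
          ((multilinear (n + 1) x - 1) * (multilinear (n + 1) x - 1) :
            Module.End ℤ (List ℕ → ℤ)) = 0 := by rw [h, mul_zero]
      have e : ∀ u : Module.End ℤ (List ℕ → ℤ), (u - 1) * (u - 1) = u * u - u - u + 1 := fun u => by
        noncomm_ring
      simp only [e, mul_add, mul_sub, ← mul_assoc, Units.inv_mul, one_mul, mul_one] at h2
      rw [← sub_eq_zero, ← h2]
      abel
    rw [this]
    exact hx.neg

lemma coeffK_mul {n : ℕ} {x y : KGrp (n + 1)} (hx : x ∈ topSubgroup n) (hy : y ∈ topSubgroup n)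
    {l : List ℕ} (hl : l ≠ []) :
    coeffK (n + 1) (x * y) l = coeffK (n + 1) x l + coeffK (n + 1) y l := by
  have h := (involves_of_mem_topSubgroup hx).mul_eq_zero (involves_of_mem_topSubgroup hy)
  have h1 : (multilinear (n + 1) (x * y) : Module.End ℤ (List ℕ → ℤ)) =
      (multilinear (n + 1) x) + (multilinear (n + 1) y) - 1 := by
    rw [map_mul, Units.val_mul]
    rw [← sub_eq_zero, ← h]
    noncomm_ring
  have h2 : oneSeries l = 0 := by simp [oneSeries, hl]
  simp only [coeffK, h1, LinearMap.sub_apply, LinearMap.add_apply, Pi.sub_apply, Pi.add_apply,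
    Module.End.one_apply, h2, sub_zero]

lemma coeffK_topCommutator {n : ℕ} {l l' : List ℕ} (hl : l ∈ words n) (hn : l.Nodup)
    (hl' : l' ∈ words n) (hn' : l'.Nodup) :
    coeffK (n + 1) (topCommutator n l) ((n + 1) :: l') = if l = l' then 1 else 0 := by
  rw [coeffK, multilinear_topCommutator hl, LinearMap.add_apply, Pi.add_apply,
    Module.End.one_apply, oneSeries_cons, zero_add]
  refine letterBracket_oneSeries (by omega) (fun j hj => ?_) hn _ (fun h => ?_) hn'
  · have := hl j hj
    omega
  · have := hl' _ h
    omega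

/-- The finite set of words in `1, …, n` without repetitions. -/
def nodupWords (n : ℕ) : Finset (List ℕ) :=
  ((List.range' 1 n).sublists.flatMap List.permutations).toFinset

lemma mem_nodupWords {n : ℕ} {l : List ℕ} : l ∈ nodupWords n ↔ l ∈ words n ∧ l.Nodup := by
  simp only [nodupWords, List.mem_toFinset, List.mem_flatMap, List.mem_sublists,
    List.mem_permutations]
  constructor
  · rintro ⟨m, hm, hl⟩
    refine ⟨fun k hk => ?_, hl.nodup_iff.2 (List.Nodup.sublist hm List.nodup_range')⟩
    have := hm.subset (hl.mem_iff.1 hk)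
    rw [List.mem_range'_1] at this
    omega
  · rintro ⟨h1, h2⟩
    obtain ⟨m, hm, hm'⟩ := List.subperm_of_subset h2 (fun k hk => by
      have := h1 k hk
      rw [List.mem_range'_1]
      omega : l ⊆ List.range' 1 n)
    exact ⟨m, hm', hm.symm⟩

/-- An element of `topSubgroup n` whose coefficients are supported on words starting with `n + 1`
and then given by the elements of `T` is generated by the commutators given by `T`. -/
lemma mem_closure_of_coeffK {n : ℕ} (T : Set (List ℕ)) {w : KGrp (n + 1)} (hw : w ∈ topSubgroup n)
    (h : ∀ l ∈ words n, l.Nodup → l ∉ T → coeffK (n + 1) w ((n + 1) :: l) = 0) :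
    w ∈ Subgroup.closure (topCommutator n '' T) := by
  let _ : CommGroup (topSubgroup n) :=
    { (inferInstance : Group (topSubgroup n)) with
      mul_comm := fun a b => Subtype.ext (commutatorsFrom_commute (closure_genK _)
        (leftCommutator_genK_eq_one _) _ a.2 b.2) }
  let c : List ℕ → topSubgroup n := fun l =>
    ⟨topCommutator n l, leftCommutator_mem_commutatorsFrom _ _ _⟩
  -- Both sides are multiplicative in `w`, so duality of commutators and words settles the
  -- generators and thereby everything.
  have key : ∀ w (hw : w ∈ topSubgroup n),
      (⟨w, hw⟩ : topSubgroup n) = ∏ l ∈ nodupWords n, c l ^ coeffK (n + 1) w ((n + 1) :: l) := by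
    intro w hw
    induction hw using Subgroup.closure_induction with
    | mem x hx =>
      obtain ⟨l, rfl⟩ := hx
      change c l = ∏ l' ∈ nodupWords n, c l' ^ coeffK (n + 1) (topCommutator n l) ((n + 1) :: l')
      by_cases hl : l ∈ words n ∧ l.Nodup
      · rw [Finset.prod_congr rfl (g := fun l' => if l = l' then c l else 1) fun l' hl' => ?_,
          Finset.prod_ite_eq, if_pos (mem_nodupWords.2 hl)]
        rw [mem_nodupWords] at hl'
        rw [coeffK_topCommutator hl.1 hl.2 hl'.1 hl'.2]
        split_ifs with h
        · rw [zpow_one, h]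
        · rw [zpow_zero]
      · have h1 : topCommutator n l = 1 := topCommutator_eq_one hl
        rw [Finset.prod_eq_one fun l' _ => by rw [h1, coeffK_one_of_ne_nil (by simp), zpow_zero]]
        exact Subtype.ext h1
    | one =>
      rw [Finset.prod_eq_one fun l' _ => by rw [coeffK_one_of_ne_nil (by simp), zpow_zero]]
      rfl
    | mul x y hx hy ihx ihy =>
      rw [Finset.prod_congr rfl fun l _ => by
        rw [coeffK_mul hx hy (List.cons_ne_nil _ _), zpow_add], Finset.prod_mul_distrib, ← ihx,
        ← ihy]
      rfl
    | inv x hx ihx =>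
      have hinv : ∀ l, coeffK (n + 1) x⁻¹ ((n + 1) :: l) = - coeffK (n + 1) x ((n + 1) :: l) := by
        intro l
        have := coeffK_mul (inv_mem hx) hx (List.cons_ne_nil (n + 1) l)
        rw [inv_mul_cancel, coeffK_one_of_ne_nil (by simp)] at this
        linarith
      rw [Finset.prod_congr rfl fun l _ => by rw [hinv, zpow_neg], Finset.prod_inv_distrib, ← ihx]
      rfl
  suffices hs : (⟨w, hw⟩ : topSubgroup n) ∈
      (Subgroup.closure (topCommutator n '' T)).comap (topSubgroup n).subtype from hs
  rw [key w hw]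
  refine Subgroup.prod_mem _ fun l hl => ?_
  rw [mem_nodupWords] at hl
  by_cases hT : l ∈ T
  · exact zpow_mem (Subgroup.subset_closure ⟨l, hT, rfl⟩ :
      topCommutator n l ∈ Subgroup.closure (topCommutator n '' T)) _
  · rw [h l hl.1 hl.2 hT, zpow_zero]
    exact one_mem _

end CohenK

namespace CohenK

open CategoryTheory Opposite
open scoped commutatorElement

/-! ### The cycles of `K(S¹)` -/

lemma mem_fullSubgroup {n : ℕ} {w : KGrp (n + 1)}
    (hw : ∀ i : Fin (n + 2), i ≠ 0 → faceK n i w = 1) : w ∈ fullSubgroup n := by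
  refine mem_closure_of_coeffK _ (mem_topSubgroup (hw _ (by simp [Fin.ext_iff])))
    fun l hl hn hf => ?_
  refine coeffK_eq_zero hw (fun k hk => ?_) (List.cons_ne_nil _ _)
    (List.nodup_cons.2 ⟨fun h => ?_, hn⟩) fun h => hf (cons_mem_fullWords_iff.1 h)
  · rcases List.mem_cons.1 hk with rfl | hk
    · omega
    · have := hl k hk
      omega
  · have := hl _ h
    omega

/-- A full commutator contains `x_1`, which `d_0` kills, and `x_{n+1}`, which `d_{n+1}` kills; any
other `d_i` makes the entries `x_i` and `x_{i+1}` equal. -/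
lemma faceK_eq_one {n : ℕ} {w : KGrp (n + 1)} (hw : w ∈ fullSubgroup n) (i : Fin (n + 2)) :
    faceK n i w = 1 := by
  suffices h : fullSubgroup n ≤ (faceK n i).ker from h hw
  rw [fullSubgroup, Subgroup.closure_le]
  rintro _ ⟨l, hl, rfl⟩
  have hl' := cons_mem_fullWords_iff.2 hl
  have e : faceK n i (topCommutator n l) = leftCommutator (genK n (collapse i (n + 1)))
      ((l.map (collapse i)).map (genK n)) := by
    rw [topCommutator, map_leftCommutator, faceK_genK, List.map_map, List.map_map]
    congr 1
    exact List.map_congr_left fun k _ => faceK_genK n i k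
  have e2 : genK n (collapse i (n + 1)) :: (l.map (collapse i)).map (genK n) =
      (((n + 1) :: l).map (collapse i)).map (genK n) := rfl
  rw [SetLike.mem_coe, MonoidHom.mem_ker, e]
  have hone : ∀ k, 1 ≤ k → k ≤ n + 1 → (collapse i k = 0 ∨ n < collapse i k) →
      leftCommutator (genK n (collapse i (n + 1))) ((l.map (collapse i)).map (genK n)) = 1 := by
    intro k hk hk' h
    refine leftCommutator_eq_one_of_mem ?_
    rw [e2, ← genK_eq_one h]
    exact List.mem_map_of_mem (List.mem_map_of_mem (mem_of_mem_fullWords hl' hk hk'))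
  by_cases h0 : (i : ℕ) = 0
  · exact hone 1 le_rfl (by omega) (Or.inl (by rw [h0]; rfl))
  by_cases h1 : (i : ℕ) = n + 1
  · exact hone (n + 1) (by omega) le_rfl (Or.inr (by rw [h1, collapse, if_pos le_rfl]; omega))
  have hi := i.2
  refine leftCommutator_genK_eq_one _ _ _ fun h => ?_
  have h2 : (((n + 1) :: l).map (collapse i)).Nodup := h
  have := List.inj_on_of_nodup_map h2 (mem_of_mem_fullWords hl' (k := i) (by omega) (by omega))
    (mem_of_mem_fullWords hl' (k := i + 1) (by omega) (by omega)) (by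
      rw [collapse, collapse, if_pos le_rfl, if_neg (by omega)]
      omega)
  omega

lemma mem_cycles_KS1 {n : ℕ} {w : KGrp (n + 1)} :
    w ∈ cycles KS1 (n + 1) ↔ ∀ i, faceK n i w = 1 := Subgroup.mem_iInf

lemma mem_cycles_FS1 {n : ℕ} {w : FGrp (n + 1)} :
    w ∈ cycles FS1 (n + 1) ↔ ∀ i, faceF n i w = 1 := Subgroup.mem_iInf

lemma mem_cycles_KS1_iff {n : ℕ} {w : KGrp (n + 1)} :
    w ∈ cycles KS1 (n + 1) ↔ w ∈ fullSubgroup n :=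
  mem_cycles_KS1.trans ⟨fun h => mem_fullSubgroup fun i _ => h i, faceK_eq_one⟩

/-- Dividing the homotopy by a constant one leaves only `d_0` possibly nontrivial. Such a simplex
lies in `fullSubgroup n`, where `d_0` is trivial too. -/
lemma eq_of_homotopic {n : ℕ} {x y : cycles KS1 n} (h : Homotopic KS1 n x y) : x = y := by
  obtain ⟨w, h0, h1, h2⟩ := h
  obtain ⟨a, a0, a1, a2⟩ := homotopic_refl KS1 n y
  have hw : w * a⁻¹ ∈ fullSubgroup n := by
    refine mem_fullSubgroup fun i hi => ?_
    change (KS1.δ i).hom (w * a⁻¹) = 1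
    by_cases hi' : i = 1
    · subst hi'
      rw [map_mul, map_inv, h1, a1, mul_inv_cancel]
    · have : 2 ≤ (i : ℕ) := by
        have h1 : (i : ℕ) ≠ 0 := fun h => hi (Fin.ext h)
        have h2 : (i : ℕ) ≠ 1 := fun h => hi' (Fin.ext h)
        omega
      rw [map_mul, map_inv, h2 i this, a2 i this, inv_one, mul_one]
  have h3 : (KS1.δ 0).hom (w * a⁻¹) = 1 := faceK_eq_one hw 0
  rw [map_mul, map_inv, h0, a0, mul_inv_eq_one] at h3
  exact Subtype.ext h3

/-- The homotopy groups of `K(S¹)` are the groups of cycles. -/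
noncomputable def cyclesEquiv (n : ℕ) : cycles KS1 n ≃* HomotopyGrp n KS1 :=
  MulEquiv.ofBijective (homotopyCon KS1 n).mk' ⟨fun _ _ h =>
    eq_of_homotopic ((Con.eq (homotopyCon KS1 n)).1 h), Con.mk'_surjective⟩

/-! ### The group `Lie(n + 1)` -/

section Lie

variable {L M : Type} [LieRing L] [LieRing M] {ι : Type}

lemma map_leftBracket [LieAlgebra ℤ L] [LieAlgebra ℤ M] (φ : L →ₗ⁅ℤ⁆ M) (x : ι → L) (i : ι)
    (l : List ι) : φ (leftBracket x i l) = leftBracket (fun k => φ (x k)) i l := by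
  induction l using List.reverseRecOn with
  | nil => rfl
  | append_singleton l j ih => rw [leftBracket_append, leftBracket_append, LieHom.map_lie, ih]

end Lie

/-- The Lie ring of which `Lie(n)` is a subgroup. -/
abbrev LieQuot (n : ℕ) : Type := FreeLieAlgebra ℤ (Fin n) ⧸ repeatedIdeal n

/-- The generators of `LieQuot n`. -/
noncomputable def lieGen (n : ℕ) (i : Fin n) : LieQuot n :=
  LieSubmodule.Quotient.mk (N := repeatedIdeal n) (FreeLieAlgebra.of ℤ i)

lemma leftBracket_lieGen (n : ℕ) (i : Fin n) (l : List (Fin n)) :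
    leftBracket (lieGen n) i l = LieSubmodule.Quotient.mk (N := repeatedIdeal n)
      (leftBracket (FreeLieAlgebra.of ℤ) i l) := by
  induction l using List.reverseRecOn with
  | nil => rfl
  | append_singleton l j ih =>
    rw [leftBracket_append, leftBracket_append, ih]
    rfl

lemma leftBracket_lieGen_eq_zero {n : ℕ} {i : Fin n} {l : List (Fin n)} (h : ¬ (i :: l).Nodup) :
    leftBracket (lieGen n) i l = 0 := by
  rw [leftBracket_lieGen]
  exact LieSubmodule.Quotient.mk_eq_zero'.2 (LieSubmodule.subset_lieSpan ⟨i, l, h, rfl⟩)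

attribute [local instance 100] LieRing.ofAssociativeRing

/-- The operators on multilinear series given by the elements of the free Lie ring. -/
noncomputable def lieToEnd (n : ℕ) : FreeLieAlgebra ℤ (Fin n) →ₗ⁅ℤ⁆ Module.End ℤ (List ℕ → ℤ) :=
  FreeLieAlgebra.lift ℤ fun i => letter (i + 1)

lemma lieToEnd_leftBracket (n : ℕ) (i : Fin n) (l : List (Fin n)) :
    lieToEnd n (leftBracket (FreeLieAlgebra.of ℤ) i l) =
      letterBracket (i + 1) (l.map fun j : Fin n => (j : ℕ) + 1) := by
  have h : ∀ j, lieToEnd n (FreeLieAlgebra.of ℤ j) = letter (j + 1) := fun j =>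
    FreeLieAlgebra.lift_of_apply ..
  rw [map_leftBracket, letterBracket, leftBracket, List.foldl_map]
  simp only [h]

lemma repeatedIdeal_le (n : ℕ) : repeatedIdeal n ≤ (lieToEnd n).ker := by
  refine LieSubmodule.lieSpan_le.2 ?_
  rintro _ ⟨i, l, h, rfl⟩
  rw [SetLike.mem_coe, LieHom.mem_ker]
  refine (lieToEnd_leftBracket n i l).trans (letterBracket_eq_zero fun h' => h ?_)
  exact List.Nodup.of_map (fun j : Fin n => (j : ℕ) + 1) (by simpa using h')

/-- The operators on multilinear series given by the elements of `LieQuot n`. -/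
noncomputable def quotToEnd (n : ℕ) : LieQuot n →ₗ[ℤ] Module.End ℤ (List ℕ → ℤ) :=
  (repeatedIdeal n).toSubmodule.liftQ (lieToEnd n : _ →ₗ[ℤ] _) fun _ ha =>
    LinearMap.mem_ker.2 (LieHom.mem_ker.1 (repeatedIdeal_le n ha))

lemma quotToEnd_leftBracket (n : ℕ) (i : Fin n) (l : List (Fin n)) :
    quotToEnd n (leftBracket (lieGen n) i l) =
      letterBracket (i + 1) (l.map fun j : Fin n => (j : ℕ) + 1) := by
  rw [leftBracket_lieGen, ← lieToEnd_leftBracket]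
  rfl

/-- The letter `k` as an element of `Fin (n + 1)`. -/
def toFin (n k : ℕ) : Fin (n + 1) := Fin.ofNat (n + 1) (k - 1)

/-- The left-normed bracket `[[…[x_{n+1}, x_{l₁}], …], x_{l_t}]`. -/
noncomputable def topBracket (n : ℕ) (l : List ℕ) : LieQuot (n + 1) :=
  leftBracket (lieGen (n + 1)) (Fin.last n) (l.map (toFin n))

lemma quotToEnd_topBracket {n : ℕ} {l : List ℕ} (hl : l ∈ words n) :
    quotToEnd (n + 1) (topBracket n l) = letterBracket (n + 1) l := by
  rw [topBracket, quotToEnd_leftBracket, Fin.val_last, List.map_map]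
  congr 1
  conv_rhs => rw [← List.map_id l]
  refine List.map_congr_left fun k hk => ?_
  have := hl k hk
  simp only [toFin, Function.comp_apply, Fin.val_ofNat, id]
  rw [Nat.mod_eq_of_lt (by omega)]
  omega

lemma quotToEnd_topBracket_oneSeries {n : ℕ} {l l' : List ℕ} (hl : l ∈ fullWords n)
    (hl' : l' ∈ fullWords n) :
    quotToEnd (n + 1) (topBracket n l) oneSeries ((n + 1) :: l') = if l = l' then 1 else 0 := by
  have hw := fullWords_subset_words _ hl
  have hw' := fullWords_subset_words _ hl'
  rw [quotToEnd_topBracket hw]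
  refine letterBracket_oneSeries (by omega) (fun j hj => ?_) (nodup_of_mem_fullWords hl) _
    (fun h => ?_) (nodup_of_mem_fullWords hl')
  · have := hw j hj
    omega
  · have := hw' _ h
    omega

lemma topBracket_mem {n : ℕ} {l : List ℕ} (hl : l ∈ fullWords n) :
    topBracket n l ∈ LieN (n + 1) := by
  refine Submodule.subset_span ?_
  have h := isBracket_leftBracket (lieGen (n + 1)) (Fin.last n) (l.map (toFin n))
  rw [List.length_map, hl.length_eq, List.length_range'] at h
  exact h

lemma leftBracket_last_mem {n : ℕ} {l : List (Fin (n + 1))} (hl : l.length = n) :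
    leftBracket (lieGen (n + 1)) (Fin.last n) l ∈
      Submodule.span ℤ (topBracket n '' fullWords n) := by
  by_cases h : (Fin.last n :: l).Nodup
  · refine Submodule.subset_span ⟨l.map fun j : Fin (n + 1) => (j : ℕ) + 1, ?_, ?_⟩
    · rw [List.nodup_cons] at h
      have hnd : (l.map fun j : Fin (n + 1) => (j : ℕ) + 1).Nodup :=
        h.2.map fun a b hab => Fin.ext (by simpa using hab)
      refine (List.subperm_of_subset hnd fun k hk => ?_).perm_of_length_le (by simp [hl])
      obtain ⟨j, hj, rfl⟩ := List.mem_map.1 hk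
      have : j ≠ Fin.last n := fun h' => h.1 (h' ▸ hj)
      have hj2 := j.2
      rw [Ne, Fin.ext_iff, Fin.val_last] at this
      rw [List.mem_range'_1]
      omega
    · rw [topBracket, List.map_map]
      congr 1
      conv_rhs => rw [← List.map_id l]
      refine List.map_congr_left fun j _ => Fin.ext ?_
      simp [toFin]
  · rw [leftBracket_lieGen_eq_zero h]
    exact zero_mem _

lemma leftBracketSpan_last_le (n : ℕ) : leftBracketSpan (lieGen (n + 1)) {Fin.last n} (n + 1) ≤
    Submodule.span ℤ (topBracket n '' fullWords n) := by
  refine Submodule.span_le.2 ?_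
  rintro _ ⟨i, rfl, l, hl, rfl⟩
  exact leftBracket_last_mem (by omega)

/-- A left-normed bracket of weight `n + 1` either repeats a generator and vanishes, or uses all of
them, in which case the last one can be moved to the front. -/
lemma LieN_le_span (n : ℕ) : LieN (n + 1) ≤ Submodule.span ℤ (topBracket n '' fullWords n) := by
  refine Submodule.span_le.2 fun a ha => ?_
  have h1 : a ∈ leftBracketSpan (lieGen (n + 1)) Set.univ (n + 1) := ha.mem_leftBracketSpan
  refine (Submodule.span_le.2 ?_ :
    leftBracketSpan (lieGen (n + 1)) Set.univ (n + 1) ≤ _) h1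
  rintro _ ⟨i, -, l, hl, rfl⟩
  by_cases h : (i :: l).Nodup
  · have hmem : Fin.last n ∈ i :: l := by
      have : (i :: l).toFinset = Finset.univ := by
        refine Finset.eq_univ_of_card _ ?_
        rw [List.toFinset_card_of_nodup h, List.length_cons, hl, Fintype.card_fin]
      rw [← List.mem_toFinset, this]
      exact Finset.mem_univ _
    have := leftBracket_mem_of_mem (lieGen (n + 1)) hmem
    rw [hl] at this
    exact leftBracketSpan_last_le n this
  · rw [leftBracket_lieGen_eq_zero h]
    exact zero_mem _

/-- The finite set of words in which each of the letters `1, …, n` occurs exactly once. -/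
def fullWordsFinset (n : ℕ) : Finset (List ℕ) := (List.range' 1 n).permutations.toFinset

lemma mem_fullWordsFinset {n : ℕ} {l : List ℕ} : l ∈ fullWordsFinset n ↔ l ∈ fullWords n := by
  rw [fullWordsFinset, List.mem_toFinset, List.mem_permutations]
  rfl

/-- The isomorphism from the group of cycles of `K(S¹)` to `Lie(n + 1)`, as a homomorphism. -/
noncomputable def cyclesToLie (n : ℕ) : cycles KS1 (n + 1) →* Multiplicative (LieN (n + 1)) where
  toFun w := Multiplicative.ofAdd ⟨∑ l ∈ fullWordsFinset n,
    coeffK (n + 1) w.1 ((n + 1) :: l) • topBracket n l, Submodule.sum_mem _ fun l hl =>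
      Submodule.smul_mem _ _ (topBracket_mem (mem_fullWordsFinset.1 hl))⟩
  map_one' := by
    refine congrArg Multiplicative.ofAdd (Subtype.ext ?_)
    change (∑ l ∈ fullWordsFinset n, _ • topBracket n l : LieQuot (n + 1)) = 0
    refine Finset.sum_eq_zero fun l _ => ?_
    have : coeffK (n + 1) (1 : cycles KS1 (n + 1)).1 ((n + 1) :: l) = 0 :=
      coeffK_one_of_ne_nil (List.cons_ne_nil _ _)
    rw [this, zero_smul]
  map_mul' x y := by
    rw [← ofAdd_add]
    refine congrArg Multiplicative.ofAdd (Subtype.ext ?_)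
    rw [Submodule.coe_add, ← Finset.sum_add_distrib]
    change (∑ l ∈ fullWordsFinset n, _ • topBracket n l : LieQuot (n + 1)) = _
    refine Finset.sum_congr rfl fun l _ => ?_
    have : coeffK (n + 1) (x * y : cycles KS1 (n + 1)).1 ((n + 1) :: l) =
        coeffK (n + 1) x.1 ((n + 1) :: l) + coeffK (n + 1) y.1 ((n + 1) :: l) :=
      coeffK_mul (fullSubgroup_le n (mem_cycles_KS1_iff.1 x.2))
        (fullSubgroup_le n (mem_cycles_KS1_iff.1 y.2)) (List.cons_ne_nil _ _)
    rw [this, add_smul]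

lemma coe_cyclesToLie {n : ℕ} (w : cycles KS1 (n + 1)) :
    ((cyclesToLie n w).toAdd : LieQuot (n + 1)) =
      ∑ l ∈ fullWordsFinset n, coeffK (n + 1) w.1 ((n + 1) :: l) • topBracket n l := rfl

/-- A cycle of `K(S¹)` is determined by its coefficients at the words in which each letter occurs
exactly once. -/
lemma eq_one_of_coeffK {n : ℕ} {w : KGrp (n + 1)} (hw : w ∈ cycles KS1 (n + 1))
    (h : ∀ l ∈ fullWords n, coeffK (n + 1) w ((n + 1) :: l) = 0) : w = 1 := by
  have h1 := mem_cycles_KS1_iff.1 hw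
  have h2 : w ∈ Subgroup.closure (topCommutator n '' ∅) := by
    refine mem_closure_of_coeffK ∅ (fullSubgroup_le n h1) fun l hl hn _ => ?_
    by_cases hf : l ∈ fullWords n
    · exact h l hf
    · refine coeffK_eq_zero (fun i _ => faceK_eq_one h1 i) (fun k hk => ?_) (List.cons_ne_nil _ _)
        (List.nodup_cons.2 ⟨fun h => ?_, hn⟩) fun h => hf (cons_mem_fullWords_iff.1 h)
      · rcases List.mem_cons.1 hk with rfl | hk
        · omega
        · have := hl k hk
          omega
      · have := hl _ h
        omega
  simpa using h2

lemma cyclesToLie_injective (n : ℕ) : Function.Injective (cyclesToLie n) := by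
  refine (injective_iff_map_eq_one _).2 fun w hw => Subtype.ext (eq_one_of_coeffK w.2 fun l hl => ?_)
  have h1 : ((cyclesToLie n w).toAdd : LieQuot (n + 1)) = 0 := by rw [hw]; rfl
  -- Evaluating at the word `(n + 1) :: l` extracts the coefficient of `topBracket n l`.
  have h2 := congrArg (fun a => quotToEnd (n + 1) a oneSeries ((n + 1) :: l)) h1
  simp only [coe_cyclesToLie, map_sum, map_smul, LinearMap.sum_apply, Finset.sum_apply,
    LinearMap.smul_apply, Pi.smul_apply, map_zero, LinearMap.zero_apply, Pi.zero_apply] at h2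
  rw [Finset.sum_congr rfl (g := fun l' => if l' = l then
    coeffK (n + 1) w.1 ((n + 1) :: l) else 0) fun l' hl' => ?_, Finset.sum_ite_eq',
    if_pos (mem_fullWordsFinset.2 hl)] at h2
  · exact h2
  · rw [quotToEnd_topBracket_oneSeries (mem_fullWordsFinset.1 hl') hl]
    split_ifs with h
    · rw [h, smul_eq_mul, mul_one]
    · rw [smul_zero]

lemma cyclesToLie_surjective (n : ℕ) : Function.Surjective (cyclesToLie n) := by
  intro a
  suffices h : ∀ a ∈ Submodule.span ℤ (topBracket n '' fullWords n),
      ∃ w : cycles KS1 (n + 1), ((cyclesToLie n w).toAdd : LieQuot (n + 1)) = a by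
    obtain ⟨w, hw⟩ := h _ (LieN_le_span n a.toAdd.2)
    exact ⟨w, Multiplicative.toAdd.injective (Subtype.ext hw)⟩
  intro a ha
  induction ha using Submodule.span_induction with
  | mem a ha =>
    obtain ⟨l, hl, rfl⟩ := ha
    refine ⟨⟨topCommutator n l, mem_cycles_KS1_iff.2 (Subgroup.subset_closure ⟨l, hl, rfl⟩)⟩, ?_⟩
    rw [coe_cyclesToLie, Finset.sum_eq_single l]
    · dsimp only
      rw [coeffK_topCommutator (fullWords_subset_words _ hl) (nodup_of_mem_fullWords hl)
        (fullWords_subset_words _ hl) (nodup_of_mem_fullWords hl), if_pos rfl, one_smul]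
    · intro l' hl' hne
      rw [mem_fullWordsFinset] at hl'
      dsimp only
      rw [coeffK_topCommutator (fullWords_subset_words _ hl) (nodup_of_mem_fullWords hl)
        (fullWords_subset_words _ hl') (nodup_of_mem_fullWords hl'), if_neg hne.symm, zero_smul]
    · intro h
      exact absurd (mem_fullWordsFinset.2 hl) h
  | zero => exact ⟨1, by rw [map_one]; rfl⟩
  | add a b _ _ iha ihb =>
    obtain ⟨w, rfl⟩ := iha
    obtain ⟨v, rfl⟩ := ihb
    exact ⟨w * v, by rw [map_mul]; rfl⟩
  | smul c a _ ih =>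
    obtain ⟨w, rfl⟩ := ih
    exact ⟨w ^ c, by rw [map_zpow, toAdd_zpow]; rfl⟩

/-! ### Low degrees -/

lemma subsingleton_KGrp_zero : Subsingleton (KGrp 0) := by
  refine ⟨fun a b => ?_⟩
  have h : ∀ a : KGrp 0, a = 1 := by
    intro a
    have ha : a ∈ Subgroup.closure (Set.range (genK 0)) := closure_genK 0 ▸ Subgroup.mem_top a
    have h1 : Subgroup.closure (Set.range (genK 0)) = ⊥ := by
      rw [eq_bot_iff, Subgroup.closure_le]
      rintro _ ⟨k, rfl⟩
      exact genK_eq_one (by omega)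
    rw [h1] at ha
    exact Subgroup.mem_bot.1 ha
  rw [h a, h b]

lemma IsBracket.one_le {ι L : Type} [LieRing L] {x : ι → L} {w : ℕ} {a : L}
    (h : IsBracket x w a) : 1 ≤ w := by
  induction h with
  | gen i => exact le_rfl
  | lie _ _ h1 h2 => omega

lemma subsingleton_LieN_zero : Subsingleton (LieN 0) := by
  have h : LieN 0 = ⊥ := by
    rw [eq_bot_iff, Submodule.span_le]
    intro a ha
    exact absurd ha.one_le (by omega)
  rw [h]
  infer_instance

lemma homotopyGrp_equiv (n : ℕ) :
    Nonempty (HomotopyGrp n KS1 ≃* Multiplicative (LieN n)) := by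
  cases n with
  | zero =>
    have h1 : Subsingleton (KS1.obj (op (.mk 0))) := subsingleton_KGrp_zero
    have h2 := subsingleton_LieN_zero
    have h3 : Subsingleton (HomotopyGrp 0 KS1) := (cyclesEquiv 0).symm.toEquiv.subsingleton
    have h4 : Subsingleton (Multiplicative (LieN 0)) := h2
    exact ⟨{ toFun := fun _ => 1
             invFun := fun _ => 1
             left_inv := fun _ => Subsingleton.elim _ _
             right_inv := fun _ => Subsingleton.elim _ _
             map_mul' := fun _ _ => Subsingleton.elim _ _ }⟩
  | succ n =>
    exact ⟨(cyclesEquiv (n + 1)).symm.trans (MulEquiv.ofBijective (cyclesToLie n)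
      ⟨cyclesToLie_injective n, cyclesToLie_surjective n⟩)⟩

lemma homotopyMap_mk {n : ℕ} (z : cycles FS1 n) :
    homotopyMap n (quotientMap SSet.S1 circlePt) ((homotopyCon FS1 n).mk' z) =
      (homotopyCon KS1 n).mk' (cyclesMap (quotientMap SSet.S1 circlePt) n z) := rfl

lemma homotopyMap_eq_one {n : ℕ} (hn : 2 < n) (a : HomotopyGrp n FS1) :
    homotopyMap n (quotientMap SSet.S1 circlePt) a = 1 := by
  obtain ⟨z, rfl⟩ := Con.mk'_surjective a
  obtain ⟨n, rfl⟩ : ∃ m, n = m + 1 := ⟨n - 1, by omega⟩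
  rw [homotopyMap_mk]
  have : cyclesMap (quotientMap SSet.S1 circlePt) (n + 1) z = 1 := by
    refine Subtype.ext (eq_one_of_coeffK (Subtype.prop _) fun l hl => ?_)
    -- After the shift of degree, `2 < n + 1` leaves at least three letters, as the shuffle argument
    -- requires.
    exact coeffK_toK_eq_zero (by omega) (mem_cycles_FS1.1 z.2) (cons_mem_fullWords_iff.2 hl)
  rw [this, map_one]

/-! ### Boundaries of `F(S¹)` and the comparison in degrees `1` and `2` -/

/-- The boundaries in `F(S¹)_n`. -/
noncomputable def boundaries (n : ℕ) : Subgroup (FGrp n) :=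
  (⨅ i : {i : Fin (n + 2) // i ≠ 0}, (faceF n i.1).ker).map (faceF n 0)

lemma faceF_zero_surjective (n : ℕ) : Function.Surjective (faceF n 0) := by
  intro w
  refine ⟨degF n 0 w, ?_⟩
  induction w using fGrp_induction with
  | gen k hk =>
    rw [degF_genF, faceF_genF]
    congr 1
    rw [Fin.val_zero, Fin.val_zero]
    rcases Nat.eq_zero_or_pos k with rfl | hk
    · rfl
    · rw [if_neg (by omega), collapse, if_neg (by omega), Nat.add_sub_cancel]
  | one => rw [map_one, map_one]
  | mul x y hx hy => rw [map_mul, map_mul, hx, hy]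
  | inv x hx => rw [map_inv, map_inv, hx]

instance boundaries_normal (n : ℕ) : (boundaries n).Normal :=
  Subgroup.Normal.map (Subgroup.normal_iInf_normal fun _ => inferInstance) _
    (faceF_zero_surjective n)

lemma mem_boundaries {n : ℕ} {x : FGrp n} {w : FGrp (n + 1)} (h0 : faceF n 0 w = x)
    (h : ∀ i, i ≠ 0 → faceF n i w = 1) : x ∈ boundaries n :=
  ⟨w, Subgroup.mem_iInf.2 fun i => h i.1 i.2, h0⟩

lemma mem_boundaries_two_left :
    ⁅⁅genF 2 1, genF 2 2⁆, genF 2 1⁆ ∈ boundaries 2 := by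
  have h0 : genF 2 0 = 1 := genF_eq_one (Or.inl rfl)
  have h3 : genF 2 3 = 1 := genF_eq_one (Or.inr (by omega))
  -- The entry `x_1⁻¹ x_2` dies under `d_1`, the inner commutator under `d_2` and `d_3`; `d_0`
  -- lowers all indices and turns `x_1` into `1`.
  refine mem_boundaries (w := ⁅⁅genF 3 2, genF 3 3⁆, (genF 3 1)⁻¹ * genF 3 2⁆) ?_ fun i hi => ?_
  · simp [-commutatorElement_inv, map_commutatorElement, faceF_genF, collapse, h0]
  · fin_cases i
    · exact absurd rfl hi
    all_goals simp [-commutatorElement_inv, map_commutatorElement, faceF_genF, collapse, h3]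

lemma mem_boundaries_two_right :
    ⁅⁅genF 2 1, genF 2 2⁆, genF 2 2⁆ ∈ boundaries 2 := by
  have h0 : genF 2 0 = 1 := genF_eq_one (Or.inl rfl)
  have h3 : genF 2 3 = 1 := genF_eq_one (Or.inr (by omega))
  rw [← inv_mem_iff]
  -- Under `d_0` only the last factor survives. Under `d_1` the last two cancel, under `d_2` the
  -- middle two, under `d_3` the first two; the remaining factors become trivial.
  refine mem_boundaries (w := ⁅⁅genF 3 1, genF 3 2⁆, (genF 3 3)⁻¹ * genF 3 2⁆ *
    ⁅⁅genF 3 1, genF 3 2⁆, genF 3 2⁆⁻¹ * ⁅⁅genF 3 1, genF 3 3⁆, genF 3 3⁆ *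
    ⁅⁅genF 3 2, genF 3 3⁆, genF 3 3⁆⁻¹) ?_ fun i hi => ?_
  · simp [-commutatorElement_inv, map_commutatorElement, faceF_genF, collapse, h0]
  · fin_cases i
    · exact absurd rfl hi
    all_goals simp [-commutatorElement_inv, map_commutatorElement, faceF_genF, collapse, h3]

lemma leftCommutator_mem {A : Type u} [Group A] (N : Subgroup A) [N.Normal] {g : A} (hg : g ∈ N)
    (l : List A) : leftCommutator g l ∈ N := by
  induction l using List.reverseRecOn with
  | nil => exact hg
  | append_singleton l a ih =>
    rw [leftCommutator_append, commutatorElement_def, mul_assoc, mul_assoc, ← mul_assoc a]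
    exact mul_mem ih (Subgroup.Normal.conj_mem inferInstance _ (inv_mem ih) _)

/-- Only `[[x_1, x_2], x_k]` needs a bounding simplex: modulo boundaries, triviality of `[[x, y],
z]` says that `z` commutes with `[x, y]`, hence with its inverse `[y, x]`. -/
lemma commutator_mem_boundaries_two {i j k : ℕ} (hi : i ≤ 2) (hj : j ≤ 2) (hk : k ≤ 2) :
    ⁅⁅genF 2 i, genF 2 j⁆, genF 2 k⁆ ∈ boundaries 2 := by
  have h0 : genF 2 0 = 1 := genF_eq_one (Or.inl rfl)
  have hinv : ∀ x y z : FGrp 2, ⁅⁅x, y⁆, z⁆ ∈ boundaries 2 → ⁅⁅y, x⁆, z⁆ ∈ boundaries 2 := by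
    intro x y z h
    rw [← QuotientGroup.eq_one_iff, ← QuotientGroup.mk'_apply, map_commutatorElement,
      commutatorElement_eq_one_iff_commute] at h ⊢
    rw [← commutatorElement_inv, map_inv]
    exact h.inv_left
  rcases Nat.eq_zero_or_pos i with rfl | hi0
  · simp [h0, one_mem]
  rcases Nat.eq_zero_or_pos j with rfl | hj0
  · simp [h0, one_mem]
  rcases Nat.eq_zero_or_pos k with rfl | hk0
  · simp [h0, one_mem]
  by_cases hij : i = j
  · simp [hij, one_mem]
  have h1 : ⁅⁅genF 2 1, genF 2 2⁆, genF 2 k⁆ ∈ boundaries 2 := by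
    rcases (by omega : k = 1 ∨ k = 2) with rfl | rfl
    · exact mem_boundaries_two_left
    · exact mem_boundaries_two_right
  rcases (by omega : i = 1 ∧ j = 2 ∨ i = 2 ∧ j = 1) with ⟨rfl, rfl⟩ | ⟨rfl, rfl⟩
  · exact h1
  · exact hinv _ _ _ h1

/-- As the boundaries form a normal subgroup, initial commutators suffice. In degree `1` there is
only one generator. In degree `2` a commutator of length two with a repetition is trivial, and a
longer one starts with a triple commutator, which is a boundary whether or not it has a repetition.
-/
lemma ker_toK_le_boundaries {n : ℕ} (hn : n = 1 ∨ n = 2) :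
    (toK n).ker ≤ boundaries n := by
  rw [QuotientGroup.ker_mk']
  refine Subgroup.normalClosure_le_normal ?_
  rintro _ ⟨x, l, hl, rfl⟩
  have h0 : ∀ n, genF n 0 = 1 := fun n => genF_eq_one (Or.inl rfl)
  rcases l with _ | ⟨y, l⟩
  · simp at hl
  obtain ⟨i, hi, rfl⟩ := exists_circleSimplex_eq n x
  obtain ⟨j, hj, rfl⟩ := exists_circleSimplex_eq n y
  change leftCommutator ⁅genF n i, genF n j⁆ _ ∈ boundaries n
  rcases hn with rfl | rfl
  · refine leftCommutator_mem _ ?_ _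
    rcases Nat.eq_zero_or_pos i with rfl | hi0
    · simp [h0, one_mem]
    rcases Nat.eq_zero_or_pos j with rfl | hj0
    · simp [h0, one_mem]
    obtain rfl : i = j := by omega
    simp [one_mem]
  · rcases l with _ | ⟨z, l⟩
    · have hij : circleSimplex 2 i = circleSimplex 2 j := by simpa using hl
      have : genF 2 i = genF 2 j := congrArg (milnorOf SSet.S1 circlePt _) hij
      refine leftCommutator_mem _ ?_ _
      rw [this]
      simp [one_mem]
    · obtain ⟨k, hk, rfl⟩ := exists_circleSimplex_eq 2 z
      exact leftCommutator_mem _ (commutator_mem_boundaries_two hi hj hk) _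

/-- The only full commutators here are `x_1` and `[x_2, x_1]`, and they are cycles already in
`F(S¹)`. -/
lemma fullSubgroup_le_map {n : ℕ} (hn : n = 0 ∨ n = 1) :
    fullSubgroup n ≤ (cycles FS1 (n + 1)).map (toK (n + 1)) := by
  rw [fullSubgroup, Subgroup.closure_le]
  rintro _ ⟨l, hl, rfl⟩
  have h0 : ∀ n, genF n 0 = 1 := fun n => genF_eq_one (Or.inl rfl)
  rcases hn with rfl | rfl
  · obtain rfl : l = [] := by simpa [fullWords] using hl
    refine ⟨genF 1 1, mem_cycles_FS1.2 fun i => ?_, rfl⟩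
    have h1 : genF 0 1 = 1 := genF_eq_one (Or.inr (by omega))
    fin_cases i <;> simp [faceF_genF, collapse, h0, h1]
  · obtain rfl : l = [1] := by simpa [fullWords] using hl
    refine ⟨⁅genF 2 2, genF 2 1⁆, mem_cycles_FS1.2 fun i => ?_, rfl⟩
    have h1 : genF 1 2 = 1 := genF_eq_one (Or.inr (by omega))
    fin_cases i <;> simp [-commutatorElement_inv, map_commutatorElement, faceF_genF, collapse, h0, h1]

lemma homotopyMap_bijective {n : ℕ} (hn : n = 0 ∨ n = 1) :
    Function.Bijective (homotopyMap (n + 1) (quotientMap SSet.S1 circlePt)) := by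
  constructor
  · refine (injective_iff_map_eq_one _).2 fun a ha => ?_
    obtain ⟨z, rfl⟩ := Con.mk'_surjective a
    rw [homotopyMap_mk] at ha
    have h1 := eq_of_homotopic ((Con.eq (homotopyCon KS1 (n + 1))).1
      (show (homotopyCon KS1 (n + 1)).mk' _ = (homotopyCon KS1 (n + 1)).mk' 1 from ha))
    have h2 : (z.1 : FGrp (n + 1)) ∈ (toK (n + 1)).ker :=
      congrArg (cycles KS1 (n + 1)).subtype h1
    obtain ⟨w, hw, hwz⟩ := ker_toK_le_boundaries (by omega) h2
    -- A simplex with `d_0 w = z` and all other faces trivial is a homotopy from `z` to `1`.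
    refine ((Con.eq (homotopyCon FS1 (n + 1))).2 ⟨w, hwz, ?_, fun i hi => ?_⟩ :
      (homotopyCon FS1 (n + 1)).mk' z = (homotopyCon FS1 (n + 1)).mk' 1)
    · exact Subgroup.mem_iInf.1 hw ⟨1, by simp⟩
    · exact Subgroup.mem_iInf.1 hw ⟨i, by rintro rfl; simp at hi⟩
  · intro a
    obtain ⟨v, rfl⟩ := Con.mk'_surjective a
    obtain ⟨z, hz, hzv⟩ := fullSubgroup_le_map hn (mem_cycles_KS1_iff.1 v.2)
    refine ⟨(homotopyCon FS1 (n + 1)).mk' ⟨z, hz⟩, ?_⟩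
    rw [homotopyMap_mk]
    exact congrArg _ (Subtype.ext hzv)

end CohenK

theorem theorem6p7 :
    (∀ n : ℕ, Nonempty (CohenK.HomotopyGrp n CohenK.KS1 ≃* Multiplicative (CohenK.LieN n))) ∧
    Function.Bijective (CohenK.homotopyMap 1 (CohenK.quotientMap SSet.S1 CohenK.circlePt)) ∧
    Function.Bijective (CohenK.homotopyMap 2 (CohenK.quotientMap SSet.S1 CohenK.circlePt)) ∧
    ∀ n : ℕ, 2 < n → ∀ a : CohenK.HomotopyGrp n CohenK.FS1,
      CohenK.homotopyMap n (CohenK.quotientMap SSet.S1 CohenK.circlePt) a = 1 :=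
  ⟨CohenK.homotopyGrp_equiv, CohenK.homotopyMap_bijective (Or.inl rfl),
    CohenK.homotopyMap_bijective (Or.inr rfl), fun _ hn a => CohenK.homotopyMap_eq_one hn a⟩
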